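/- Let $d\ge 2$, $m>0$, $L>0$, $\lambda,\kappa\in\mathbb{R}$, $B=[-L/2,L/2]^d\subset\mathbb{R}^d$, and let $V:\mathbb{R}\to\mathbb{R}$ be bounded and measurable. For $\Lambda\ge e$ let $$C_\Lambda(x)=\int_{\mathbb{R}^d}\frac{dp}{(2\pi)^d}\,e^{ipx}\,\frac{e^{-(p^2+m^2)/\Lambda^2}}{p^2+m^2},\qquad C(x)=\lim_{\Lambda\to\infty}C_\Lambda(x)\ (x\neq 0),\qquad \langle\delta_x,CJ\rangle=\int C(x-y)J(y)\,dy .$$ Let $\nu_\Lambda$ be the Gaussian measure with mean zero on the real tempered distributions $\phi$ on $\mathbb{R}^d$ with the renormalized covariance $C_\Lambda(0)\,C_\Lambda(x-y)$, and write $\langle\,\cdot\,\rangle_\Lambda$ for the expectation with respect to $\nu_\Lambda$. Put $z_\Lambda=C_\Lambda(0)^\kappa$ and, for a real Schwartz function $J\in S(\mathbb{R}^d;\mathbb{R})$, $$\hat S^{\mathrm c}_\Lambda(J)=\log\frac{\big\langle e^{\phi(J)}\exp\big(-\lambda\int_B V(z_\Lambda\phi(x))\,dx\big)\big\rangle_\Lambda}{\langle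 e^{\phi(J)}\rangle_\Lambda},$$ where $\phi(x)$ is the value at $x$ of the continuous function that $\phi$ almost surely is near $B$; the expectations are those of integrable random variables. Then the limit $\hat S^{\mathrm c}(J)=\lim_{\Lambda\to\infty}\hat S^{\mathrm c}_\Lambda(J)$ exists for every $J\in S(\mathbb{R}^d;\mathbb{R})$ in each of the following cases and has the stated form. (d.1) If $\kappa<-1$ and the limits $V_\pm=\lim_{w\to0^\pm}V(w)$ exist, then $$\hat S^{\mathrm c}(J)=-\lambda|B|\frac{V_++V_-}{2}-\lambda\frac{V_+-V_-}{2}\,\frac{1}{(2\pi)^{1/2}}\int_B dx\int_{\mathbb{R}}dw\,\mathrm{sgn}(w)\,e^{-\frac12(w-\langle\delta_x,CJ\rangle)^2}.$$ Moreover, if $\lambda\neq0$, then $\hat S^{\mathrm c}$ is non-Gaussian (that is, for some $n\ge3$ and some $f_1,\dots,f_n\in S(\mathbb{R}^d;\mathbb{R})$ the smeared connected Schwinger function $\partial_{\varepsilon_1}\cdots\partial_{\varepsilon_n}\hat S^{\mathrm c}(\sum_i\varepsilon_if_i)|_{\varepsilon=0}$ is nonzero) if and only if $V_+\neq V_-$.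 (d.2) If $\kappa=-1$, then, without further assumptions, $$\hat S^{\mathrm c}(J)=-\lambda\,\frac{1}{(2\pi)^{1/2}}\int_B dx\int_{\mathbb{R}}dw\,V(w)\,e^{-\frac12(w-\langle\delta_x,CJ\rangle)^2}.$$ (d.3) If $\kappa>-1$ and the limits $V^\pm=\lim_{w\to\pm\infty}V(w)$ exist, then $$\hat S^{\mathrm c}(J)=-\lambda|B|\frac{V^++V^-}{2}-\lambda\frac{V^+-V^-}{2}\,\frac{1}{(2\pi)^{1/2}}\int_B dx\int_{\mathbb{R}}dw\,\mathrm{sgn}(w)\,e^{-\frac12(w-\langle\delta_x,CJ\rangle)^2}.$$ -/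

import Mathlib

open MeasureTheory Filter Topology Set
open scoped SchwartzMap

namespace BoundedQFT

noncomputable section

/-- Euclidean space `ℝ^d`. -/
abbrev Space (d : ℕ) : Type := EuclideanSpace ℝ (Fin d)

/-- Real tempered distributions on `ℝ^d`: the field configurations. -/
abbrev TField (d : ℕ) : Type := 𝓢(Space d, ℝ) →L[ℝ] ℝ

/-- The cylinder σ-algebra: the smallest one for which all smeared fields `φ ↦ φ(J)` are
measurable. -/
instance TField.measurableSpace (d : ℕ) : MeasurableSpace (TField d) :=
  ⨆ J : 𝓢(Space d, ℝ), MeasurableSpace.comap (fun φ : TField d => φ J) inferInstance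

/-- The finite volume `[-L/2, L/2]^d`. -/
def box (d : ℕ) (L : ℝ) : Set (Space d) :=
  {x | ∀ i, x i ∈ Set.Icc (-(L / 2)) (L / 2)}

/-- The free covariance of mass `m` with UV cut-off `Λ`,
`C_Λ(x) = ∫ dp/(2π)^d e^{ipx} e^{-(p²+m²)/Λ²} / (p²+m²)` (the integral is real, as the weight is
even in `p`). -/
def covCutoff (d : ℕ) (m Λ : ℝ) (x : Space d) : ℝ :=
  (∫ p : Space d, Complex.exp (Complex.I * (inner ℝ p x : ℝ)) *
    ((Real.exp (-(‖p‖ ^ 2 + m ^ 2) / Λ ^ 2) / (‖p‖ ^ 2 + m ^ 2) / (2 * Real.pi) ^ d : ℝ) : ℂ)).re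

/-- The free covariance `C(x) = lim_{Λ → ∞} C_Λ(x)`. The limit is finite for `x ≠ 0`; for `d ≥ 2`
it is infinite at the single point `x = 0`, and the value there plays no role, as `C` is only used
as an integral kernel. -/
def cov (d : ℕ) (m : ℝ) (x : Space d) : ℝ :=
  limUnder atTop (fun Λ : ℝ => covCutoff d m Λ x)

/-- `⟨δ_x, K J⟩ = ∫ dy K(x - y) J(y)`, the action of a translation invariant kernel. -/
def smear {d : ℕ} (K : Space d → ℝ) (J : 𝓢(Space d, ℝ)) (x : Space d) : ℝ :=
  ∫ y, K (x - y) * J y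

/-- `ν` is the Gaussian measure with mean zero and covariance kernel `K(x - y)` on the tempered
distributions: its characteristic functional is `exp (-⟨J, K J⟩ / 2)`. -/
structure IsCenteredGaussian {d : ℕ} (ν : Measure (TField d)) (K : Space d → ℝ) : Prop where
  prob : IsProbabilityMeasure ν
  charFunctional : ∀ J : 𝓢(Space d, ℝ),
    ∫ φ, Complex.exp (Complex.I * (φ J : ℝ)) ∂ν
      = ((Real.exp (-(1 / 2) * ∫ x, J x * smear K J x) : ℝ) : ℂ)

/-- A bump function at the origin with support in the closed ball of radius `1 / (n + 1)`. -/
def bump (d : ℕ) (n : ℕ) : ContDiffBump (0 : Space d) where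
  rIn := 1 / (2 * ((n : ℝ) + 1))
  rOut := 1 / ((n : ℝ) + 1)
  rIn_pos := by positivity
  rIn_lt_rOut := by
    apply one_div_lt_one_div_of_lt <;> [positivity; nlinarith [n.cast_nonneg (α := ℝ)]]

/-- The mollifiers: nonnegative Schwartz functions with integral one and with support in the closed
ball of radius `1 / (n + 1)` about the origin. -/
def mollifier (d : ℕ) (n : ℕ) : 𝓢(Space d, ℝ) :=
  HasCompactSupport.toSchwartzMap (f := (bump d n).normed volume)
    (bump d n).hasCompactSupport_normed (bump d n).contDiff_normed

/-- The value `φ(x)` of a distribution at a point: the limit of the mollified values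
`φ(ρ_n(· - x))`. If `φ` coincides with a continuous function in a neighbourhood of `x`, then this
is the value of that function at `x`, see `TField.value_eq` below. -/
def TField.value {d : ℕ} (φ : TField d) (x : Space d) : ℝ :=
  limUnder atTop (fun n : ℕ => φ (SchwartzMap.compSubConstCLM ℝ x (mollifier d n)))

theorem TField.value_eq {d : ℕ} (φ : TField d) (f : Space d → ℝ) (x : Space d) (r : ℝ) (hr : 0 < r)
    (hf : ContinuousOn f (Metric.ball x r))
    (h : ∀ J : 𝓢(Space d, ℝ), tsupport J ⊆ Metric.ball x r → φ J = ∫ y, f y * J y) :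
    φ.value x = f x := by
  set g : Space d → ℝ := (Metric.ball x r).indicator f with hg
  have hrOut : Tendsto (fun n => (bump d n).rOut) atTop (𝓝 0) := by
    simpa [bump] using tendsto_one_div_add_atTop_nhds_zero_nat (𝕜 := ℝ)
  have hgm : AEStronglyMeasurable g volume :=
    (aestronglyMeasurable_indicator_iff Metric.isOpen_ball.measurableSet).2
      (hf.aestronglyMeasurable Metric.isOpen_ball.measurableSet)
  have hgx : g x = f x := Set.indicator_of_mem (Metric.mem_ball_self hr) f
  have hgc : Tendsto g (𝓝 x) (𝓝 (f x)) := by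
    have h1 : Tendsto f (𝓝 x) (𝓝 (f x)) :=
      hf.continuousAt (Metric.isOpen_ball.mem_nhds (Metric.mem_ball_self hr))
    refine h1.congr' ?_
    filter_upwards [Metric.isOpen_ball.mem_nhds (Metric.mem_ball_self hr)] with y hy
    exact (Set.indicator_of_mem hy f).symm
  have key := ContDiffBump.convolution_tendsto_right (μ := (volume : Measure (Space d)))
    (φ := bump d) (g := fun _ => g) (k := fun _ => x) (x₀ := x) (z₀ := f x) hrOut
    (Eventually.of_forall fun _ => hgm) (hgc.comp tendsto_snd) tendsto_const_nhds
  refine Tendsto.limUnder_eq (key.congr' ?_)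
  filter_upwards [hrOut.eventually (gt_mem_nhds hr)] with n hn
  have hsub : ∀ y, SchwartzMap.compSubConstCLM ℝ x (mollifier d n) y
      = (bump d n).normed volume (y - x) := fun y => rfl
  have hsupp : tsupport (SchwartzMap.compSubConstCLM ℝ x (mollifier d n))
      ⊆ Metric.closedBall x (bump d n).rOut := by
    refine closure_minimal ?_ Metric.isClosed_closedBall
    intro y hy
    have hy' : y - x ∈ Function.support ((bump d n).normed volume) := by
      rw [Function.mem_support, ← hsub]; exact hy
    rw [ContDiffBump.support_normed_eq, mem_ball_zero_iff] at hy'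
    rw [Metric.mem_closedBall, dist_eq_norm]
    exact hy'.le
  rw [h _ (hsupp.trans (Metric.closedBall_subset_ball hn)), convolution_lsmul_swap]
  refine integral_congr_ae (Eventually.of_forall fun y => ?_)
  simp only [smul_eq_mul, hsub]
  have hsymm : (bump d n).normed volume (x - y) = (bump d n).normed volume (y - x) := by
    rw [← ContDiffBump.normed_neg, neg_sub]
  rw [hsymm, mul_comm]
  by_cases hy : y ∈ Metric.ball x r
  · rw [hg, Set.indicator_of_mem hy]
  · have h0 : (bump d n).normed volume (y - x) = 0 := by
      by_contra hne
      have hmem : y - x ∈ Function.support ((bump d n).normed volume) := hne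
      rw [ContDiffBump.support_normed_eq, mem_ball_zero_iff, ← dist_eq_norm] at hmem
      exact hy (Metric.mem_ball.2 (hmem.trans hn))
    rw [h0, mul_zero, mul_zero]

/-- The interaction term `∫_B dx W(φ(x))` in the box `B = [-L/2, L/2]^d`. -/
def interaction {d : ℕ} (L : ℝ) (W : ℝ → ℝ) (φ : TField d) : ℝ :=
  ∫ x in box d L, W (φ.value x)

/-- The generating functional of the free theory, `⟨e^{φ(J)}⟩`. -/
def freeGenerating {d : ℕ} (ν : Measure (TField d)) (J : 𝓢(Space d, ℝ)) : ℝ :=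
  ∫ φ, Real.exp (φ J) ∂ν

/-- The generating functional of the interacting theory, `⟨e^{φ(J)} e^{-λ ∫_B W(φ(x)) dx}⟩`. -/
def generating {d : ℕ} (ν : Measure (TField d)) (lam L : ℝ) (W : ℝ → ℝ) (J : 𝓢(Space d, ℝ)) : ℝ :=
  ∫ φ, Real.exp (φ J) * Real.exp (-lam * interaction L W φ) ∂ν

/-- The connected modified generating functional: the logarithm of the quotient of the interacting
and of the free generating functionals. -/
def connectedGenerating {d : ℕ} (ν : Measure (TField d)) (lam L : ℝ) (W : ℝ → ℝ)
    (J : 𝓢(Space d, ℝ)) : ℝ :=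
  Real.log (generating ν lam L W J / freeGenerating ν J)

/-- The functional
`J ↦ -λ |B| (a + b) / 2 - λ (a - b) / 2 * (2π)^{-1/2} ∫_B dx ∫ dw sgn(w) e^{-(w - ⟨δ_x, C J⟩)² / 2}`. -/
def erfFunctional (d : ℕ) (m lam L a b : ℝ) (J : 𝓢(Space d, ℝ)) : ℝ :=
  -lam * volume.real (box d L) * ((a + b) / 2)
    - lam * ((a - b) / 2) * (1 / Real.sqrt (2 * Real.pi)) *
      ∫ x in box d L, ∫ w : ℝ,
        (SignType.sign w : ℝ) * Real.exp (-(1 / 2) * (w - smear (cov d m) J x) ^ 2)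

/-- The functional `J ↦ -λ (2π)^{-1/2} ∫_B dx ∫ dw V(w) e^{-(w - ⟨δ_x, C J⟩)² / 2}`. -/
def convFunctional (d : ℕ) (m lam L : ℝ) (V : ℝ → ℝ) (J : 𝓢(Space d, ℝ)) : ℝ :=
  -lam * (1 / Real.sqrt (2 * Real.pi)) *
    ∫ x in box d L, ∫ w : ℝ, V w * Real.exp (-(1 / 2) * (w - smear (cov d m) J x) ^ 2)

/-- The `n`-point connected Schwinger function of a connected generating functional `F`, smeared
with `f_1, …, f_n`: the mixed derivative `∂_{ε_1} ⋯ ∂_{ε_n} F(∑ ε_i f_i)` at `ε = 0`. -/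
def schwinger {d : ℕ} (F : 𝓢(Space d, ℝ) → ℝ) (n : ℕ) (f : Fin n → 𝓢(Space d, ℝ)) : ℝ :=
  iteratedFDeriv ℝ n (fun ε : Fin n → ℝ => F (∑ i, ε i • f i)) 0 (fun i => Pi.single i 1)

/-- Non-Gaussianity: some connected Schwinger function of order at least three does not vanish. -/
def IsNonGaussian {d : ℕ} (F : 𝓢(Space d, ℝ) → ℝ) : Prop :=
  ∃ n : ℕ, 3 ≤ n ∧ ∃ f : Fin n → 𝓢(Space d, ℝ), schwinger F n f ≠ 0

end

end BoundedQFT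

open BoundedQFT

namespace BoundedQFT

open ProbabilityTheory

/-! ### Exponential tilting of jointly Gaussian variables. -/

section Gaussian

variable {Ω : Type*} [MeasurableSpace Ω] {P : Measure Ω}

/-! The limit is a law of large numbers. Under the renormalized covariance, `φ(x) / C_Λ(0)` has
variance one at every point, and the correlation of two points is `C_Λ(x - y) / C_Λ(0)`. For `d ≥ 2`
the denominator diverges while the numerator stays finite for almost every `x - y`, so the
normalized field decorrelates at almost all pairs of points. Dividing by the free generating
functional amounts to tilting the measure by `e^{φ(J)}`. By Cameron–Martin this shifts the
normalized field by `⟨δ_x, C_Λ J⟩` and leaves its covariances alone (`map_tilted_eq_prod`,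
`tilted_integral_value`).

Under the tilted measure the interaction is the integral over `B` of uniformly bounded,
asymptotically independent variables. Its mean tends to `c`, the integral over `B` of Gaussian
expectations centred at `⟨δ_x, CJ⟩`, and its second moment tends to `c²`
(`tendsto_integral_prod_mul`). The variance thus vanishes, the exponential moment tends to `e^{-λc}`
(`tendsto_integral_exp_of_moments`), and the logarithm gives `-λc` (`tendsto_connectedGenerating`).

The three regimes differ only in the pointwise limit of the potential in the normalized variable
`w`, where it reads `V(C_Λ(0)^{κ+1} w)`. The argument tends to zero, is constant, or tends to
infinity, giving the one-sided limits of `V` at the origin, `V` itself, or its limits at infinity.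
As `V` is merely measurable, the moving parameters are put into the Gaussian density instead of the
argument of `V` (`tendsto_integral_affine_gaussian`).

A step function yields an error function of `⟨δ_x, CJ⟩`. Its third derivative at the origin is
nonzero and `C` is positive, so a nonnegative test function detects a nonzero third Schwinger
function; with equal one-sided limits the functional is constant in `J`.

Analytic facts on `C_Λ` come from its proper-time representation as a heat kernel integral over `t >
1/Λ²` (`covCutoff_eq`). That point values exist almost surely, as limits of mollified fields, is
`IsCenteredGaussian.ae_tendsto_value`. -/

lemma gaussian_of_charFun [IsProbabilityMeasure P] {X : Ω → ℝ} (hX : Measurable X) {A : ℝ}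
    (h : ∀ t : ℝ, ∫ ω, Complex.exp (Complex.I * ((t * X ω : ℝ) : ℂ)) ∂P
      = ((Real.exp (-(1 / 2) * (t ^ 2 * A)) : ℝ) : ℂ)) :
    0 ≤ A ∧ P.map X = gaussianReal 0 A.toNNReal := by
  have hA : 0 ≤ A := by
    have h1 : ‖∫ ω, Complex.exp (Complex.I * ((1 * X ω : ℝ) : ℂ)) ∂P‖ ≤ 1 := by
      refine (norm_integral_le_integral_norm _).trans (le_of_eq ?_)
      simp [mul_comm Complex.I, Complex.norm_exp_ofReal_mul_I]
    rw [h 1, Complex.norm_real, Real.norm_eq_abs, Real.abs_exp, Real.exp_le_one_iff] at h1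
    linarith
  refine ⟨hA, ?_⟩
  have := Measure.isProbabilityMeasure_map (μ := P) hX.aemeasurable
  refine Measure.ext_of_charFun (funext fun t => ?_)
  rw [charFun_apply_real, integral_map hX.aemeasurable (by fun_prop), charFun_gaussianReal]
  have := h t
  simp only [Complex.ofReal_mul] at this
  simp only [mul_comm _ Complex.I, this]
  rw [Complex.ofReal_exp]
  congr 1
  push_cast [Real.coe_toNNReal _ hA]
  ring

/-- Regression on `X`: the residual `W = Z - cX` is uncorrelated with `X`, hence independent of it,
and the expectation factors into two complex moment generating functions. This continues the
characteristic function to the imaginary argument that tilting requires. -/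
lemma integral_exp_add_I_mul [IsProbabilityMeasure P] {X Z : Ω → ℝ} (hX : Measurable X)
    (hZ : Measurable Z) {A B D : ℝ}
    (h : ∀ u v : ℝ, ∫ ω, Complex.exp (Complex.I * ((u * X ω + v * Z ω : ℝ) : ℂ)) ∂P
      = ((Real.exp (-(1 / 2) * (u ^ 2 * A + 2 * u * v * B + v ^ 2 * D)) : ℝ) : ℂ)) :
    ∫ ω, Complex.exp (X ω + Complex.I * Z ω) ∂P
      = Complex.exp ((A - D) / 2 + Complex.I * B) := by
  obtain ⟨hA, hXlaw⟩ := gaussian_of_charFun (P := P) hX (A := A) fun t => by simpa using h t 0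
  set c : ℝ := B / A with hc
  have hcA : c * A = B := by
    -- In the degenerate case division by zero makes `c = 0`, so `B = 0` is needed. It follows
    -- because an affine function of `u` that is bounded below has zero slope.
    rcases eq_or_ne A 0 with h0 | h0
    · have key : ∀ u : ℝ, 0 ≤ 2 * u * B + D := by
        intro u
        have h1 : ‖∫ ω, Complex.exp (Complex.I * ((u * X ω + 1 * Z ω : ℝ) : ℂ)) ∂P‖ ≤ 1 := by
          refine (norm_integral_le_integral_norm _).trans (le_of_eq ?_)
          simp only [mul_comm Complex.I, Complex.norm_exp_ofReal_mul_I]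
          simp
        rw [h u 1, Complex.norm_real, Real.norm_eq_abs, Real.abs_exp, Real.exp_le_one_iff, h0] at h1
        linarith
      have hB : B = 0 := by
        by_contra hB
        have := key (-(D + 1) / (2 * B))
        have h2 : 2 * (-(D + 1) / (2 * B)) * B = -(D + 1) := by field_simp
        linarith
      rw [h0, hB, mul_zero]
    · rw [hc, div_mul_cancel₀ _ h0]
  set W : Ω → ℝ := fun ω => Z ω - c * X ω with hW
  have hWm : Measurable W := by fun_prop
  have hXW : ∀ u v : ℝ, ∫ ω, Complex.exp (Complex.I * ((u * X ω + v * W ω : ℝ) : ℂ)) ∂P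
      = ((Real.exp (-(1 / 2) * (u ^ 2 * A + v ^ 2 * (D - c * B))) : ℝ) : ℂ) := by
    intro u v
    have := h (u - v * c) v
    have e1 : ∀ ω, (u - v * c) * X ω + v * Z ω = u * X ω + v * W ω := fun ω => by
      simp only [hW]; ring
    simp only [e1] at this
    rw [this]
    congr 3
    rw [← hcA]
    ring
  obtain ⟨hD, hWlaw⟩ := gaussian_of_charFun (P := P) hWm (A := D - c * B)
    fun t => by simpa using hXW 0 t
  have hind : IndepFun X W P := by
    rw [indepFun_iff_charFun_prod hX.aemeasurable hWm.aemeasurable]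
    intro t
    rw [hXlaw, hWlaw, charFun_gaussianReal, charFun_gaussianReal, charFun_apply,
      integral_map (by fun_prop) (by fun_prop), ← Complex.exp_add]
    have e := hXW t.ofLp.1 t.ofLp.2
    have e2 : ∀ ω, ((inner ℝ (WithLp.toLp 2 (X ω, W ω)) t : ℝ) : ℂ) * Complex.I
        = Complex.I * ((t.ofLp.1 * X ω + t.ofLp.2 * W ω : ℝ) : ℂ) := fun ω => mul_comm _ _
    simp only [e2]
    refine e.trans ?_
    rw [Complex.ofReal_exp]
    congr 1
    push_cast [Real.coe_toNNReal _ hA, Real.coe_toNNReal _ hD]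
    ring
  have e1 : ∀ ω, Complex.exp (X ω + Complex.I * Z ω)
      = Complex.exp ((1 + Complex.I * c) * X ω) * Complex.exp (Complex.I * W ω) := by
    intro ω
    rw [← Complex.exp_add]
    congr 1
    simp only [hW]
    push_cast
    ring
  have hi : IndepFun (fun ω => Complex.exp ((1 + Complex.I * c) * X ω))
      (fun ω => Complex.exp (Complex.I * W ω)) P :=
    hind.comp (φ := fun x : ℝ => Complex.exp ((1 + Complex.I * c) * x))
      (ψ := fun x : ℝ => Complex.exp (Complex.I * x)) (by fun_prop) (by fun_prop)
  simp only [e1]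
  rw [hi.integral_fun_mul_eq_mul_integral (by fun_prop) (by fun_prop)]
  have h1 := complexMGF_gaussianReal hXlaw (1 + Complex.I * c)
  have h2 := complexMGF_gaussianReal hWlaw Complex.I
  simp only [complexMGF] at h1 h2
  rw [h1, h2, ← Complex.exp_add]
  congr 1
  push_cast [Real.coe_toNNReal _ hA, Real.coe_toNNReal _ hD]
  have hcA' : (c : ℂ) * A = B := by exact_mod_cast hcA
  rw [← hcA']
  ring_nf
  simp only [Complex.I_sq]
  ring

lemma integrable_exp_of_gaussian {X : Ω → ℝ} (hX : Measurable X) {A : NNReal}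
    (h : P.map X = gaussianReal 0 A) : Integrable (fun ω => Real.exp (X ω)) P := by
  have h1 : Integrable (fun x : ℝ => Real.exp (1 * x)) (P.map X) := by
    rw [h]; exact integrable_exp_mul_gaussianReal 1
  simpa [Function.comp_def] using h1.comp_measurable hX

lemma tilted_integral_complex {X : Ω → ℝ} (g : Ω → ℂ) :
    ∫ ω, g ω ∂(P.tilted X)
      = (∫ ω, (Real.exp (X ω) : ℂ) * g ω ∂P) / ((∫ ω, Real.exp (X ω) ∂P : ℝ) : ℂ) := by
  rw [integral_tilted, ← integral_div]
  congr 1 with ω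
  rw [Complex.real_smul]
  push_cast
  ring

/-- Under the measure tilted by one component of a centred Gaussian triple, the two other
components are Gaussian, with the same covariance and with means given by the covariances with the
tilting component. -/
lemma map_tilted_eq_prod [IsProbabilityMeasure P] {X Y Z : Ω → ℝ} (hX : Measurable X)
    (hY : Measurable Y)
    (hZ : Measurable Z) {A a b r : ℝ} (hr : r ^ 2 < 1)
    (h : ∀ u s t : ℝ,
      ∫ ω, Complex.exp (Complex.I * ((u * X ω + s * Y ω + t * Z ω : ℝ) : ℂ)) ∂P
      = ((Real.exp (-(1 / 2) * (u ^ 2 * A + s ^ 2 + t ^ 2 + 2 * u * s * a + 2 * u * t * b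
        + 2 * s * t * r)) : ℝ) : ℂ)) :
    (P.tilted X).map (fun ω => (Y ω - a, (Z ω - b - r * (Y ω - a)) / √(1 - r ^ 2)))
      = (gaussianReal 0 1).prod (gaussianReal 0 1) := by
  obtain ⟨hA, hXlaw⟩ := gaussian_of_charFun (P := P) hX (A := A) fun t => by simpa using h t 0 0
  have hint := integrable_exp_of_gaussian hX hXlaw
  have := isProbabilityMeasure_tilted hint
  set σ := √(1 - r ^ 2) with hσ
  have hσ2 : σ ^ 2 = 1 - r ^ 2 := Real.sq_sqrt (by linarith)
  have hσ0 : σ ≠ 0 := by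
    intro h0
    rw [h0] at hσ2
    linarith
  have hmap := Measure.isProbabilityMeasure_map (μ := P.tilted X)
    (f := fun ω => (Y ω - a, (Z ω - b - r * (Y ω - a)) / σ)) (by fun_prop)
  rw [← charFun_eq_prod_iff]
  intro t
  rw [charFun_gaussianReal, charFun_gaussianReal, charFun_apply,
    integral_map (by fun_prop) (by fun_prop), integral_map (by fun_prop) (by fun_prop),
    tilted_integral_complex]
  -- Transposing the whitening map: up to the constant from the means, the pairing with `t` is `s₁ Y
  -- + s₂ Z`.
  set s₁ : ℝ := t.ofLp.1 - t.ofLp.2 * r / σ with hs₁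
  set s₂ : ℝ := t.ofLp.2 / σ with hs₂
  have hnum := integral_exp_add_I_mul (P := P) (Z := fun ω => s₁ * Y ω + s₂ * Z ω) hX (by fun_prop)
    (A := A) (B := s₁ * a + s₂ * b) (D := s₁ ^ 2 + s₂ ^ 2 + 2 * s₁ * s₂ * r) (fun u v => by
      have := h u (v * s₁) (v * s₂)
      have e1 : ∀ ω, u * X ω + v * s₁ * Y ω + v * s₂ * Z ω
          = u * X ω + v * (s₁ * Y ω + s₂ * Z ω) := fun ω => by ring
      simp only [e1] at this
      rw [this]
      congr 3
      ring)
  have hden : ∫ ω, Real.exp (X ω) ∂P = Real.exp (A / 2) := by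
    have := mgf_gaussianReal hXlaw 1
    simpa [mgf, Real.coe_toNNReal _ hA] using this
  have hfun : ∀ ω, (Real.exp (X ω) : ℂ) * Complex.exp ((inner ℝ
        (WithLp.toLp 2 (Y ω - a, (Z ω - b - r * (Y ω - a)) / σ)) t : ℝ) * Complex.I)
      = Complex.exp (X ω + Complex.I * ((s₁ * Y ω + s₂ * Z ω : ℝ) : ℂ))
        * Complex.exp (-Complex.I * (s₁ * a + s₂ * b)) := by
    intro ω
    rw [Complex.ofReal_exp, ← Complex.exp_add, ← Complex.exp_add]
    congr 1
    have hi : (inner ℝ (WithLp.toLp 2 (Y ω - a, (Z ω - b - r * (Y ω - a)) / σ)) t : ℝ)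
        = s₁ * Y ω + s₂ * Z ω - (s₁ * a + s₂ * b) := by
      simp only [WithLp.prod_inner_apply, RCLike.inner_apply, conj_trivial, hs₁, hs₂]
      change t.ofLp.1 * (Y ω - a) + t.ofLp.2 * ((Z ω - b - r * (Y ω - a)) / σ) = _
      field_simp
      ring
    rw [hi]
    push_cast
    ring
  simp only [hfun]
  rw [integral_mul_const, hnum, hden, Complex.ofReal_exp, ← Complex.exp_add, ← Complex.exp_sub,
    ← Complex.exp_add]
  congr 1
  -- The covariance becomes the identity in the whitened coordinates, which yields the product law.
  have hq : s₁ ^ 2 + s₂ ^ 2 + 2 * s₁ * s₂ * r = t.ofLp.1 ^ 2 + t.ofLp.2 ^ 2 := by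
    simp only [hs₁, hs₂]
    field_simp
    linear_combination (-(t.ofLp.2 ^ 2)) * hσ2
  have hq' : (s₁ : ℂ) ^ 2 + s₂ ^ 2 + 2 * s₁ * s₂ * r = (t.ofLp.1 : ℂ) ^ 2 + t.ofLp.2 ^ 2 := by
    exact_mod_cast hq
  push_cast
  rw [hq']
  ring

/-- Inverts the whitening map. The reference measure on the right is fixed, so all dependence on the
cut-off will sit in the three numbers `a`, `b`, `r`. -/
lemma tilted_integral_pair [IsProbabilityMeasure P] {X Y Z : Ω → ℝ} (hX : Measurable X)
    (hY : Measurable Y)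
    (hZ : Measurable Z) {A a b r : ℝ} (hr : r ^ 2 < 1)
    (h : ∀ u s t : ℝ,
      ∫ ω, Complex.exp (Complex.I * ((u * X ω + s * Y ω + t * Z ω : ℝ) : ℂ)) ∂P
      = ((Real.exp (-(1 / 2) * (u ^ 2 * A + s ^ 2 + t ^ 2 + 2 * u * s * a + 2 * u * t * b
        + 2 * s * t * r)) : ℝ) : ℂ)) {F : ℝ × ℝ → ℝ} (hF : Measurable F) :
    ∫ ω, F (Y ω, Z ω) ∂(P.tilted X)
      = ∫ p, F (p.1 + a, r * p.1 + b + √(1 - r ^ 2) * p.2)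
          ∂((gaussianReal 0 1).prod (gaussianReal 0 1)) := by
  rw [← map_tilted_eq_prod hX hY hZ hr h]
  refine Eq.trans ?_ (integral_map (by fun_prop) (hF.comp (by fun_prop)).aestronglyMeasurable).symm
  have hσ0 : √(1 - r ^ 2) ≠ 0 := (Real.sqrt_pos.2 (by linarith)).ne'
  congr 1 with ω
  congr 1
  ext
  · simp
  · simp only
    field_simp
    ring

end Gaussian

/-! ### Continuity of translation in Schwartz space. -/

section Translation

variable {E : Type*} [NormedAddCommGroup E] [NormedSpace ℝ E]

/-- The mean value inequality in the translation parameter bounds each seminorm of the difference by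
a constant times `‖x - x₀‖`. This serves the joint measurability of mollified fields. -/
lemma continuous_compSubConstCLM (f : 𝓢(E, ℝ)) :
    Continuous fun x : E => SchwartzMap.compSubConstCLM ℝ x f := by
  rw [continuous_iff_continuousAt]
  intro x₀
  rw [ContinuousAt, (schwartz_withSeminorms ℝ E ℝ).tendsto_nhds]
  rintro ⟨k, l⟩ ε hε
  obtain ⟨C₁, hC₁, h₁⟩ := f.decay k (l + 1)
  obtain ⟨C₂, hC₂, h₂⟩ := f.decay 0 (l + 1)
  -- For `z` in the unit ball about `x₀` the weight obeys `‖y‖ ^ k ≤ 2 ^ k (‖y - z‖ ^ k + (‖x₀‖ + 1)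
  -- ^ k)`; the two decay bounds control the two terms.
  set C : ℝ := 2 ^ k * (C₁ + (‖x₀‖ + 1) ^ k * C₂) with hC
  have hCpos : 0 < C := by positivity
  have hbound : ∀ y : E, ∀ z ∈ Metric.ball x₀ 1,
      ‖y‖ ^ k * ‖iteratedFDeriv ℝ (l + 1) f (y - z)‖ ≤ C := by
    intro y z hz
    have hz' : ‖z‖ ≤ ‖x₀‖ + 1 := by
      have : ‖z - x₀‖ < 1 := by simpa [dist_eq_norm] using hz
      calc ‖z‖ = ‖x₀ + (z - x₀)‖ := by rw [add_sub_cancel]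
        _ ≤ ‖x₀‖ + ‖z - x₀‖ := norm_add_le _ _
        _ ≤ ‖x₀‖ + 1 := by linarith
    have hy : ‖y‖ ^ k ≤ 2 ^ k * (‖y - z‖ ^ k + (‖x₀‖ + 1) ^ k) := by
      have h0 : ‖y‖ ≤ 2 * max ‖y - z‖ (‖x₀‖ + 1) := by
        calc ‖y‖ = ‖(y - z) + z‖ := by rw [sub_add_cancel]
          _ ≤ ‖y - z‖ + ‖z‖ := norm_add_le _ _
          _ ≤ 2 * max ‖y - z‖ (‖x₀‖ + 1) := by
            linarith [le_max_left ‖y - z‖ (‖x₀‖ + 1), le_max_right ‖y - z‖ (‖x₀‖ + 1)]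
      calc ‖y‖ ^ k ≤ (2 * max ‖y - z‖ (‖x₀‖ + 1)) ^ k := by gcongr
        _ = 2 ^ k * (max ‖y - z‖ (‖x₀‖ + 1)) ^ k := mul_pow _ _ _
        _ ≤ 2 ^ k * (‖y - z‖ ^ k + (‖x₀‖ + 1) ^ k) := by
          gcongr
          rcases max_choice ‖y - z‖ (‖x₀‖ + 1) with h | h <;> rw [h]
          · exact le_add_of_nonneg_right (by positivity)
          · exact le_add_of_nonneg_left (by positivity)
    calc ‖y‖ ^ k * ‖iteratedFDeriv ℝ (l + 1) f (y - z)‖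
        ≤ 2 ^ k * (‖y - z‖ ^ k + (‖x₀‖ + 1) ^ k) * ‖iteratedFDeriv ℝ (l + 1) f (y - z)‖ := by
          gcongr
      _ = 2 ^ k * (‖y - z‖ ^ k * ‖iteratedFDeriv ℝ (l + 1) f (y - z)‖
          + (‖x₀‖ + 1) ^ k * (‖y - z‖ ^ 0 * ‖iteratedFDeriv ℝ (l + 1) f (y - z)‖)) := by ring
      _ ≤ C := by
          rw [hC]
          gcongr
          · exact h₁ _
          · exact h₂ _
  have hdiff : Differentiable ℝ (iteratedFDeriv ℝ l f) :=
    (f.smooth ⊤).differentiable_iteratedFDeriv (by exact_mod_cast WithTop.coe_lt_top _)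
  have hmain : ∀ x ∈ Metric.ball x₀ 1, SchwartzMap.seminorm ℝ k l
      (SchwartzMap.compSubConstCLM ℝ x f - SchwartzMap.compSubConstCLM ℝ x₀ f) ≤ C * ‖x - x₀‖ := by
    intro x hx
    refine SchwartzMap.seminorm_le_bound ℝ k l _ (by positivity) fun y => ?_
    have e1 : ∀ z : E, iteratedFDeriv ℝ l (SchwartzMap.compSubConstCLM ℝ z f) y
        = iteratedFDeriv ℝ l f (y - z) := fun z => iteratedFDeriv_comp_sub (f := f) l z y
    have e2 : iteratedFDeriv ℝ l
        (SchwartzMap.compSubConstCLM ℝ x f - SchwartzMap.compSubConstCLM ℝ x₀ f : 𝓢(E, ℝ)) y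
        = iteratedFDeriv ℝ l f (y - x) - iteratedFDeriv ℝ l f (y - x₀) := by
      rw [← e1, ← e1]
      exact iteratedFDeriv_sub_apply ((SchwartzMap.smooth _ l).contDiffAt)
        ((SchwartzMap.smooth _ l).contDiffAt)
    rw [e2]
    have hd : ∀ z ∈ Metric.ball x₀ (1 : ℝ), HasFDerivWithinAt
        (fun z => ‖y‖ ^ k • iteratedFDeriv ℝ l f (y - z))
        (‖y‖ ^ k • -(fderiv ℝ (iteratedFDeriv ℝ l f) (y - z))) (Metric.ball x₀ 1) z := by
      intro z _
      have h1 : HasFDerivAt (fun z => iteratedFDeriv ℝ l f (y - z))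
          (-(fderiv ℝ (iteratedFDeriv ℝ l f) (y - z))) z := by
        have := (hdiff (y - z)).hasFDerivAt.comp z ((hasFDerivAt_id z).const_sub y)
        simpa [Function.comp_def] using this
      exact (h1.const_smul (‖y‖ ^ k)).hasFDerivWithinAt
    have := (convex_ball x₀ (1 : ℝ)).norm_image_sub_le_of_norm_hasFDerivWithin_le (C := C) hd
      (fun z hz => by
        rw [norm_smul, norm_neg, norm_fderiv_iteratedFDeriv, norm_pow, norm_norm]
        exact hbound y z hz) (Metric.mem_ball_self one_pos) hx
    rwa [← smul_sub, norm_smul, norm_pow, norm_norm] at this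
  have hlim : Tendsto (fun x => C * ‖x - x₀‖) (𝓝 x₀) (𝓝 0) := by
    have : Continuous fun x => C * ‖x - x₀‖ := by fun_prop
    simpa using this.tendsto x₀
  filter_upwards [hlim.eventually (gt_mem_nhds hε), Metric.ball_mem_nhds x₀ one_pos] with x h1 h2
  exact (hmain x h2).trans_lt h1

end Translation

/-! ### Measurability of point values. -/

variable {d : ℕ}

lemma measurable_eval (f : 𝓢(Space d, ℝ)) : Measurable fun φ : TField d => φ f :=
  Measurable.of_comap_le (le_iSup
    (fun J : 𝓢(Space d, ℝ) => MeasurableSpace.comap (fun φ : TField d => φ J) inferInstance) f)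

/-- The mollifier centred at `x`. -/
noncomputable abbrev bumpAt (x : Space d) (n : ℕ) : 𝓢(Space d, ℝ) :=
  SchwartzMap.compSubConstCLM ℝ x (mollifier d n)

/-- A Carathéodory function: continuous in the point and measurable in the field. -/
lemma measurable_eval_bumpAt (n : ℕ) :
    Measurable fun p : TField d × Space d => p.1 (bumpAt p.2 n) := by
  have h0 := continuous_compSubConstCLM (mollifier d n)
  have hc : ∀ φ : TField d, Continuous fun x : Space d => φ (bumpAt x n) := fun φ =>
    Continuous.comp φ.cont h0
  have hm : ∀ x : Space d, Measurable fun φ : TField d => φ (bumpAt x n) := fun x =>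
    measurable_eval _
  have := measurable_uncurry_of_continuous_of_measurable (ι := Space d) (α := TField d) (β := ℝ)
    (u := fun (x : Space d) (φ : TField d) => φ (bumpAt x n)) hc hm
  exact this.comp measurable_swap

lemma measurable_value : Measurable fun p : TField d × Space d => p.1.value p.2 := by
  have h := StronglyMeasurable.limUnder (l := atTop)
    (f := fun (n : ℕ) (p : TField d × Space d) => p.1 (bumpAt p.2 n))
    fun n => (measurable_eval_bumpAt n).stronglyMeasurable
  exact h.measurable

lemma measurable_value_right (x : Space d) : Measurable fun φ : TField d => φ.value x :=
  measurable_value.of_uncurry_right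

/-! ### Regular kernels and their covariance forms. -/

section Kernel

/-- Translation invariant kernels which are bounded, continuous, even, and twice differentiable at
the origin in the sense of a quadratic bound. -/
structure IsRegularKernel (K : Space d → ℝ) : Prop where
  continuous : Continuous K
  bounded : ∃ M, ∀ x, |K x| ≤ M
  even : ∀ x, K (-x) = K x
  quadratic : ∃ A, 0 ≤ A ∧ ∀ x, |K x - K 0| ≤ A * ‖x‖ ^ 2

/-- The bilinear form `⟨f, K g⟩`. -/
noncomputable def covForm (K : Space d → ℝ) (f g : 𝓢(Space d, ℝ)) : ℝ :=
  ∫ x, f x * smear K g x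

variable {K : Space d → ℝ}

namespace IsRegularKernel

lemma integrable_mul (hK : IsRegularKernel K) (g : 𝓢(Space d, ℝ)) (x : Space d) :
    Integrable fun y => K (x - y) * g y := by
  obtain ⟨M, hM⟩ := hK.bounded
  exact g.integrable.bdd_mul (c := M)
    (hK.continuous.comp (by fun_prop : Continuous fun y => x - y)).aestronglyMeasurable
    (Eventually.of_forall fun y => hM _)

lemma continuous_smear (hK : IsRegularKernel K) (g : 𝓢(Space d, ℝ)) : Continuous (smear K g) := by
  obtain ⟨M, hM⟩ := hK.bounded
  refine continuous_of_dominated (bound := fun y => M * ‖g y‖)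
    (fun x => (hK.integrable_mul g x).aestronglyMeasurable)
      (fun x => Eventually.of_forall fun y => ?_)
    ((g.integrable (μ := volume)).norm.const_mul M) (Eventually.of_forall fun y => ?_)
  · rw [norm_mul]
    gcongr
    exact hM _
  · exact (hK.continuous.comp (by fun_prop)).mul continuous_const

lemma smear_bounded (hK : IsRegularKernel K) (g : 𝓢(Space d, ℝ)) :
    ∃ M, ∀ x, |smear K g x| ≤ M := by
  obtain ⟨M, hM⟩ := hK.bounded
  have hg : Integrable (fun y => M * ‖g y‖) := (g.integrable (μ := volume)).norm.const_mul M
  refine ⟨∫ y, M * ‖g y‖, fun x => ?_⟩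
  rw [smear, ← Real.norm_eq_abs]
  refine norm_integral_le_of_norm_le hg (Eventually.of_forall fun y => ?_)
  rw [norm_mul]
  gcongr
  exact hM _

lemma integrable_mul_smear (hK : IsRegularKernel K) (f g : 𝓢(Space d, ℝ)) :
    Integrable fun x => f x * smear K g x := by
  obtain ⟨M, hM⟩ := hK.smear_bounded g
  exact (f.integrable (μ := volume)).mul_bdd (c := M) (hK.continuous_smear g).aestronglyMeasurable
    (Eventually.of_forall fun y => hM _)

lemma smear_add (hK : IsRegularKernel K) (f g : 𝓢(Space d, ℝ)) (x : Space d) :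
    smear K (f + g) x = smear K f x + smear K g x := by
  simp only [smear, add_apply, mul_add]
  exact integral_add (hK.integrable_mul f x) (hK.integrable_mul g x)

lemma smear_smul (c : ℝ) (g : 𝓢(Space d, ℝ)) (x : Space d) :
    smear K (c • g) x = c * smear K g x := by
  simp only [smear, smul_apply, smul_eq_mul]
  rw [← integral_const_mul]
  congr 1 with y
  ring

lemma covForm_add_right (hK : IsRegularKernel K) (f g h : 𝓢(Space d, ℝ)) :
    covForm K f (g + h) = covForm K f g + covForm K f h := by
  simp only [covForm, hK.smear_add, mul_add]
  exact integral_add (hK.integrable_mul_smear f g) (hK.integrable_mul_smear f h)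

lemma covForm_add_left (hK : IsRegularKernel K) (f g h : 𝓢(Space d, ℝ)) :
    covForm K (f + g) h = covForm K f h + covForm K g h := by
  simp only [covForm, add_apply, add_mul]
  exact integral_add (hK.integrable_mul_smear f h) (hK.integrable_mul_smear g h)

lemma covForm_smul_right (c : ℝ) (f g : 𝓢(Space d, ℝ)) :
    covForm K f (c • g) = c * covForm K f g := by
  simp only [covForm, smear_smul]
  rw [← integral_const_mul]
  congr 1 with y
  ring

lemma covForm_smul_left (c : ℝ) (f g : 𝓢(Space d, ℝ)) :
    covForm K (c • f) g = c * covForm K f g := by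
  simp only [covForm, smul_apply, smul_eq_mul]
  rw [← integral_const_mul]
  congr 1 with y
  ring

lemma covForm_comm (hK : IsRegularKernel K) (f g : 𝓢(Space d, ℝ)) :
    covForm K f g = covForm K g f := by
  obtain ⟨M, hM⟩ := hK.bounded
  simp only [covForm, smear, ← integral_const_mul]
  rw [integral_integral_swap]
  · refine integral_congr_ae (Eventually.of_forall fun y => ?_)
    refine integral_congr_ae (Eventually.of_forall fun x => ?_)
    simp only
    rw [← hK.even (y - x), neg_sub]
    ring
  · have h1 : Integrable (fun p : Space d × Space d => f p.1 * g p.2) :=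
      f.integrable.mul_prod g.integrable
    have h2 := h1.bdd_mul (c := M) (f := fun p : Space d × Space d => K (p.1 - p.2))
      (hK.continuous.comp (by fun_prop)).aestronglyMeasurable
      (Eventually.of_forall fun y => hM _)
    refine h2.congr (Eventually.of_forall fun p => ?_)
    simp only [Function.uncurry]
    ring

/-- Cross terms carry `J` on the right, so that mollifiers in the places of `f` and `g` lead to
values of `smear K J`. -/
lemma covForm_comb (hK : IsRegularKernel K) (u s t : ℝ) (J f g : 𝓢(Space d, ℝ)) :
    covForm K (u • J + s • f + t • g) (u • J + s • f + t • g)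
      = u ^ 2 * covForm K J J + s ^ 2 * covForm K f f + t ^ 2 * covForm K g g
        + 2 * u * s * covForm K f J + 2 * u * t * covForm K g J + 2 * s * t * covForm K f g := by
  simp only [hK.covForm_add_left, hK.covForm_add_right, covForm_smul_left, covForm_smul_right]
  rw [hK.covForm_comm J f, hK.covForm_comm J g, hK.covForm_comm g f]
  ring

end IsRegularKernel

lemma bumpAt_apply (x : Space d) (n : ℕ) (y : Space d) :
    bumpAt x n y = (bump d n).normed volume (y - x) := rfl

lemma bumpAt_nonneg (x : Space d) (n : ℕ) (y : Space d) : 0 ≤ bumpAt x n y :=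
  (bump d n).nonneg_normed _

lemma integral_bumpAt (x : Space d) (n : ℕ) : ∫ y, bumpAt x n y = 1 := by
  simp only [bumpAt_apply]
  rw [integral_sub_right_eq_self (fun y => (bump d n).normed volume y)]
  exact (bump d n).integral_normed

lemma bumpAt_eq_zero {x : Space d} {n : ℕ} {y : Space d} (h : 1 / ((n : ℝ) + 1) ≤ dist y x) :
    bumpAt x n y = 0 := by
  by_contra hne
  have hmem : y - x ∈ Function.support ((bump d n).normed volume) := hne
  rw [ContDiffBump.support_normed_eq, mem_ball_zero_iff, ← dist_eq_norm] at hmem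
  exact absurd hmem (not_lt.2 h)

lemma abs_integral_bumpAt_sub_le {x : Space d} {n : ℕ} {h : Space d → ℝ}
    (hc : Continuous h) {M : ℝ} (hM : ∀ y, |h y| ≤ M) {k ε : ℝ}
    (hk : ∀ y, dist y x < 1 / ((n : ℝ) + 1) → |h y - k| ≤ ε) :
    |(∫ y, bumpAt x n y * h y) - k| ≤ ε := by
  have hi : Integrable fun y => bumpAt x n y * h y :=
    (SchwartzMap.integrable (μ := volume) (bumpAt x n)).mul_bdd (c := M) hc.aestronglyMeasurable
      (Eventually.of_forall fun y => hM _)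
  have e : (∫ y, bumpAt x n y * h y) - k = ∫ y, bumpAt x n y * (h y - k) := by
    simp only [mul_sub]
    rw [integral_sub hi ((SchwartzMap.integrable (μ := volume) (bumpAt x n)).mul_const k),
      integral_mul_const, integral_bumpAt,
      one_mul]
  rw [e]
  have h2 : ∫ y, bumpAt x n y * ε = ε := by rw [integral_mul_const, integral_bumpAt, one_mul]
  conv_rhs => rw [← h2]
  refine norm_integral_le_of_norm_le (f := fun y => bumpAt x n y * (h y - k))
    ((SchwartzMap.integrable (μ := volume) (bumpAt x n)).mul_const ε)
      (Eventually.of_forall fun y => ?_)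
  rw [norm_mul, Real.norm_eq_abs, abs_of_nonneg (bumpAt_nonneg x n y)]
  by_cases hy : dist y x < 1 / ((n : ℝ) + 1)
  · exact mul_le_mul_of_nonneg_left (hk y hy) (bumpAt_nonneg x n y)
  · rw [bumpAt_eq_zero (not_lt.1 hy)]
    simp

/-- The form is a double average of the kernel against probability densities, so the averaging
estimate applies once in each variable. -/
lemma IsRegularKernel.abs_covForm_bumpAt_sub_le (hK : IsRegularKernel K) {x y : Space d} {n m : ℕ}
    {k ε : ℝ} (hk : ∀ u v, dist u x < 1 / ((n : ℝ) + 1) → dist v y < 1 / ((m : ℝ) + 1) →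
      |K (u - v) - k| ≤ ε) : |covForm K (bumpAt x n) (bumpAt y m) - k| ≤ ε := by
  obtain ⟨M, hM⟩ := hK.bounded
  obtain ⟨M', hM'⟩ := hK.smear_bounded (bumpAt y m)
  refine abs_integral_bumpAt_sub_le (hK.continuous_smear _) hM' fun u hu => ?_
  have e : smear K (bumpAt y m) u = ∫ v, bumpAt y m v * K (u - v) := by
    simp only [smear, mul_comm]
  rw [e]
  exact abs_integral_bumpAt_sub_le (hK.continuous.comp (by fun_prop : Continuous fun v => u - v))
    (fun v => hM _) fun v hv => hk u v hu hv

lemma eventually_ball_of_continuous {h : Space d → ℝ} (hc : Continuous h) (x : Space d) {ε : ℝ}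
    (hε : 0 < ε) : ∃ δ > 0, ∀ y, dist y x < δ → |h y - h x| ≤ ε := by
  obtain ⟨δ, hδ, H⟩ := Metric.continuous_iff.1 hc x ε hε
  exact ⟨δ, hδ, fun y hy => (H y hy).le⟩

lemma IsRegularKernel.tendsto_covForm_bumpAt_left (hK : IsRegularKernel K) (x : Space d)
    (J : 𝓢(Space d, ℝ)) :
    Tendsto (fun n => covForm K (bumpAt x n) J) atTop (𝓝 (smear K J x)) := by
  obtain ⟨M, hM⟩ := hK.smear_bounded J
  rw [Metric.tendsto_nhds]
  intro ε hε
  obtain ⟨δ, hδ, H⟩ := eventually_ball_of_continuous (hK.continuous_smear J) x (half_pos hε)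
  filter_upwards [tendsto_one_div_add_atTop_nhds_zero_nat (𝕜 := ℝ) |>.eventually
    (gt_mem_nhds hδ)] with n hn
  refine lt_of_le_of_lt ?_ (half_lt_self hε)
  exact abs_integral_bumpAt_sub_le (hK.continuous_smear J) hM fun y hy => H y (hy.trans hn)

lemma IsRegularKernel.tendsto_covForm_bumpAt (hK : IsRegularKernel K) (x y : Space d) :
    Tendsto (fun n => covForm K (bumpAt x n) (bumpAt y n)) atTop (𝓝 (K (x - y))) := by
  rw [Metric.tendsto_nhds]
  intro ε hε
  obtain ⟨δ, hδ, H⟩ := eventually_ball_of_continuous hK.continuous (x - y) (half_pos hε)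
  filter_upwards [tendsto_one_div_add_atTop_nhds_zero_nat (𝕜 := ℝ) |>.eventually
    (gt_mem_nhds (half_pos hδ))] with n hn
  refine lt_of_le_of_lt ?_ (half_lt_self hε)
  refine hK.abs_covForm_bumpAt_sub_le fun u v hu hv => H _ ?_
  refine (dist_sub_sub_le u v x y).trans_lt ?_
  linarith

end Kernel

/-! ### Laws of smeared fields and of point values. -/

section Field

variable {K : Space d → ℝ} {ν : Measure (TField d)}

lemma IsCenteredGaussian.charFun_comb (hν : IsCenteredGaussian ν K) (hK : IsRegularKernel K)
    (J f g : 𝓢(Space d, ℝ)) (u s t : ℝ) :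
    ∫ φ : TField d, Complex.exp (Complex.I * ((u * φ J + s * φ f + t * φ g : ℝ) : ℂ)) ∂ν
      = ((Real.exp (-(1 / 2) * (u ^ 2 * covForm K J J + s ^ 2 * covForm K f f
        + t ^ 2 * covForm K g g + 2 * u * s * covForm K f J + 2 * u * t * covForm K g J
        + 2 * s * t * covForm K f g)) : ℝ) : ℂ) := by
  have := hν.charFunctional (u • J + s • f + t • g)
  change _ = ((Real.exp (-(1 / 2) * covForm K _ _) : ℝ) : ℂ) at this
  rw [hK.covForm_comb] at this
  simpa only [map_add, map_smul, smul_eq_mul] using this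

lemma IsCenteredGaussian.law (hν : IsCenteredGaussian ν K) (f : 𝓢(Space d, ℝ)) :
    0 ≤ covForm K f f ∧
      ν.map (fun φ : TField d => φ f) = gaussianReal 0 (covForm K f f).toNNReal := by
  have := hν.prob
  refine gaussian_of_charFun (measurable_eval f) fun t => ?_
  have := hν.charFunctional (t • f)
  change _ = ((Real.exp (-(1 / 2) * covForm K _ _) : ℝ) : ℂ) at this
  rw [IsRegularKernel.covForm_smul_left, IsRegularKernel.covForm_smul_right] at this
  simp only [map_smul, smul_eq_mul] at this
  rw [this]
  congr 3
  ring

lemma IsCenteredGaussian.memLp (hν : IsCenteredGaussian ν K) (f : 𝓢(Space d, ℝ)) :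
    MemLp (fun φ : TField d => φ f) 2 ν := by
  have h := memLp_id_gaussianReal (μ := 0) (v := (covForm K f f).toNNReal) 2
  rw [← (hν.law f).2] at h
  exact h.comp_measurePreserving ⟨measurable_eval f, rfl⟩

lemma IsCenteredGaussian.integral_sq (hν : IsCenteredGaussian ν K) (f : 𝓢(Space d, ℝ)) :
    ∫ φ : TField d, (φ f) ^ 2 ∂ν = covForm K f f := by
  obtain ⟨h0, hl⟩ := hν.law f
  have h1 : ∫ x, x ^ 2 ∂(ν.map (fun φ : TField d => φ f)) = ∫ φ : TField d, (φ f) ^ 2 ∂ν :=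
    integral_map (measurable_eval f).aemeasurable (by fun_prop)
  rw [← h1, hl]
  have h2 := variance_of_integral_eq_zero (X := fun x : ℝ => x)
    (μ := gaussianReal 0 (covForm K f f).toNNReal) (by fun_prop)
    (by simp)
  rw [← h2, variance_fun_id_gaussianReal, Real.coe_toNNReal _ h0]

lemma IsCenteredGaussian.integrable_exp (hν : IsCenteredGaussian ν K) (f : 𝓢(Space d, ℝ)) :
    Integrable (fun φ : TField d => Real.exp (φ f)) ν :=
  have := hν.prob
  integrable_exp_of_gaussian (measurable_eval f) (hν.law f).2

/-- By Tonelli the sum of the functions has finite integral, so it is finite almost everywhere and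
its terms vanish in the limit. -/
lemma ae_tendsto_zero_of_summable_integral {Ω : Type*} [MeasurableSpace Ω] {P : Measure Ω}
    {g : ℕ → Ω → ℝ} (hg : ∀ n, Integrable (g n) P) (h0 : ∀ n ω, 0 ≤ g n ω)
    (hs : Summable fun n => ∫ ω, g n ω ∂P) :
    ∀ᵐ ω ∂P, Tendsto (fun n => g n ω) atTop (𝓝 0) := by
  have h1 : ∑' n, ∫⁻ ω, ENNReal.ofReal (g n ω) ∂P ≠ ⊤ := by
    have e : ∀ n, ∫⁻ ω, ENNReal.ofReal (g n ω) ∂P = ENNReal.ofReal (∫ ω, g n ω ∂P) := fun n =>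
      (ofReal_integral_eq_lintegral_ofReal (hg n) (Eventually.of_forall (h0 n))).symm
    simp only [e]
    rw [← ENNReal.ofReal_tsum_of_nonneg (fun n => integral_nonneg (h0 n)) hs]
    exact ENNReal.ofReal_ne_top
  rw [← lintegral_tsum fun n => (hg n).aemeasurable.ennreal_ofReal] at h1
  have h2 := ae_lt_top' (AEMeasurable.tsum fun n => (hg n).aemeasurable.ennreal_ofReal) h1
  filter_upwards [h2] with ω hω
  have h3 := ENNReal.tendsto_atTop_zero_of_tsum_ne_top hω.ne
  have h4 := (ENNReal.tendsto_toReal ENNReal.zero_ne_top).comp h3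
  simpa [Function.comp_def, ENNReal.toReal_ofReal (h0 _ ω)] using h4

lemma norm_sq_eq_integral {Ω : Type*} [MeasurableSpace Ω] {P : Measure Ω} (f : Lp ℝ 2 P) :
    ‖f‖ ^ 2 = ∫ ω, (f ω) ^ 2 ∂P := by
  rw [← real_inner_self_eq_norm_sq, L2.inner_def]
  congr 1 with ω
  rw [real_inner_self_eq_norm_sq, Real.norm_eq_abs, sq_abs]

/-- The quadratic bound on the kernel makes the mollified values Cauchy in `L²` at rate `1/(n+1)`.
The squared rate is summable, so the whole sequence converges almost surely, without passing to a
subsequence, and `value` is then a genuine limit and not the default of `limUnder`. -/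
lemma IsCenteredGaussian.ae_tendsto_value (hν : IsCenteredGaussian ν K) (hK : IsRegularKernel K)
    (x : Space d) :
    ∀ᵐ φ ∂ν, Tendsto (fun n => (φ : TField d) (bumpAt x n)) atTop (𝓝 (φ.value x)) := by
  have hprob := hν.prob
  obtain ⟨A, hA, hq⟩ := hK.quadratic
  set Y : ℕ → Lp ℝ 2 ν := fun n => (hν.memLp (bumpAt x n)).toLp _ with hY
  -- The squared distance is a second difference of covariances, each within `e = 4A/(n+1)²` of `K
  -- 0`; it is at most `4e = 16A/(n+1)²`.
  have hdist : ∀ n m : ℕ, n ≤ m → ‖Y n - Y m‖ ≤ 4 * √A * (1 / ((n : ℝ) + 1)) := by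
    intro n m hnm
    have hq' : ∀ i j : ℕ, n ≤ i → n ≤ j →
        |covForm K (bumpAt x i) (bumpAt x j) - K 0| ≤ A * (2 * (1 / ((n : ℝ) + 1))) ^ 2 := by
      intro i j hi hj
      refine hK.abs_covForm_bumpAt_sub_le fun u v hu hv => (hq _).trans ?_
      have hi' : 1 / ((i : ℝ) + 1) ≤ 1 / ((n : ℝ) + 1) := by gcongr
      have hj' : 1 / ((j : ℝ) + 1) ≤ 1 / ((n : ℝ) + 1) := by gcongr
      have : ‖u - v‖ ≤ 2 * (1 / ((n : ℝ) + 1)) := by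
        rw [← dist_eq_norm]
        have := dist_triangle_right u v x
        linarith
      gcongr
    have h1 : ‖Y n - Y m‖ ^ 2 ≤ (4 * √A * (1 / ((n : ℝ) + 1))) ^ 2 := by
      have e1 : ‖Y n - Y m‖ ^ 2 = covForm K ((0 : ℝ) • bumpAt x n + (1 : ℝ) • bumpAt x n
          + (-1 : ℝ) • bumpAt x m) ((0 : ℝ) • bumpAt x n + (1 : ℝ) • bumpAt x n
          + (-1 : ℝ) • bumpAt x m) := by
        rw [norm_sq_eq_integral, ← hν.integral_sq]
        refine integral_congr_ae ?_
        filter_upwards [Lp.coeFn_sub (Y n) (Y m), (hν.memLp (bumpAt x n)).coeFn_toLp,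
          (hν.memLp (bumpAt x m)).coeFn_toLp] with φ h1 h2 h3
        simp only [hY] at h1 ⊢
        rw [h1, Pi.sub_apply, h2, h3]
        simp [sub_eq_add_neg]
      rw [e1, hK.covForm_comb, mul_pow, mul_pow, Real.sq_sqrt hA]
      have a1 := abs_le.1 (hq' n n le_rfl le_rfl)
      have a2 := abs_le.1 (hq' n m le_rfl hnm)
      have a3 := abs_le.1 (hq' m m hnm hnm)
      nlinarith
    exact le_of_sq_le_sq h1 (by positivity)
  have hlim0 : Tendsto (fun n : ℕ => 4 * √A * (1 / ((n : ℝ) + 1))) atTop (𝓝 0) := by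
    simpa using (tendsto_one_div_add_atTop_nhds_zero_nat (𝕜 := ℝ)).const_mul (4 * √A)
  have hcau : CauchySeq Y := cauchySeq_of_le_tendsto_0' _
    (fun n m hnm => by rw [dist_eq_norm]; exact hdist n m hnm) hlim0
  obtain ⟨y, hy⟩ := cauchySeq_tendsto_of_complete hcau
  have hny : ∀ n, ‖Y n - y‖ ≤ 4 * √A * (1 / ((n : ℝ) + 1)) := fun n =>
    le_of_tendsto (tendsto_const_nhds.sub hy).norm
      (by filter_upwards [eventually_ge_atTop n] with m hm using hdist n m hm)
  have hsum : Summable fun n => ∫ φ, ((Y n - y : Lp ℝ 2 ν) φ) ^ 2 ∂ν := by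
    simp only [← norm_sq_eq_integral]
    have hs : Summable fun n : ℕ => (4 * √A) ^ 2 * (1 / ((n : ℝ) + 1) ^ 2) := by
      have h0 : Summable fun n : ℕ => 1 / ((n : ℝ)) ^ 2 :=
          Real.summable_one_div_nat_pow.2 one_lt_two
      have := (summable_nat_add_iff 1).2 h0
      push_cast at this
      exact this.mul_left _
    refine hs.of_nonneg_of_le (fun n => by positivity) fun n => ?_
    calc ‖Y n - y‖ ^ 2 ≤ (4 * √A * (1 / ((n : ℝ) + 1))) ^ 2 := by gcongr; exact hny n
      _ = _ := by rw [mul_pow, one_div_pow]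
  have hae := ae_tendsto_zero_of_summable_integral (P := ν)
    (fun n => (Lp.memLp (Y n - y)).integrable_sq) (fun n φ => sq_nonneg _) hsum
  have hcoe : ∀ᵐ φ ∂ν, ∀ n, (Y n - y : Lp ℝ 2 ν) φ = φ (bumpAt x n) - y φ := by
    rw [ae_all_iff]
    intro n
    filter_upwards [Lp.coeFn_sub (Y n) y, (hν.memLp (bumpAt x n)).coeFn_toLp] with φ h1 h2
    simp only [hY] at h1 ⊢
    rw [h1, Pi.sub_apply, h2]
  filter_upwards [hae, hcoe] with φ h1 h2
  have h3 : Tendsto (fun n => φ (bumpAt x n) - y φ) atTop (𝓝 0) := by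
    simp only [h2] at h1
    have := h1.sqrt
    simp only [Real.sqrt_sq_eq_abs, Real.sqrt_zero] at this
    exact (tendsto_zero_iff_abs_tendsto_zero _).2 this
  have h4 : Tendsto (fun n => φ (bumpAt x n)) atTop (𝓝 (y φ)) := by
    simpa using h3.add_const (y φ)
  rw [show φ.value x = y φ from h4.limUnder_eq]
  exact h4

/-- The joint characteristic function of one smeared field and two point values. -/
lemma IsCenteredGaussian.charFun_value (hν : IsCenteredGaussian ν K) (hK : IsRegularKernel K)
    (J : 𝓢(Space d, ℝ)) (x y : Space d) (u s t : ℝ) :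
    ∫ φ : TField d,
        Complex.exp (Complex.I * ((u * φ J + s * φ.value x + t * φ.value y : ℝ) : ℂ)) ∂ν
      = ((Real.exp (-(1 / 2) * (u ^ 2 * covForm K J J + s ^ 2 * K 0 + t ^ 2 * K 0
        + 2 * u * s * smear K J x + 2 * u * t * smear K J y + 2 * s * t * K (x - y))) : ℝ) : ℂ) :=
          by
  have hprob := hν.prob
  have h1 : Tendsto (fun n => ∫ φ : TField d, Complex.exp (Complex.I *
      ((u * φ J + s * φ (bumpAt x n) + t * φ (bumpAt y n) : ℝ) : ℂ)) ∂ν) atTop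
      (𝓝 (∫ φ : TField d,
        Complex.exp (Complex.I * ((u * φ J + s * φ.value x + t * φ.value y : ℝ) : ℂ)) ∂ν)) := by
    refine tendsto_integral_of_dominated_convergence (fun _ => (1 : ℝ)) (fun n => ?_)
      (integrable_const _) (fun n => Eventually.of_forall fun φ => ?_) ?_
    · have m1 := measurable_eval J
      have m2 := measurable_eval (bumpAt x n)
      have m3 := measurable_eval (bumpAt y n)
      have m4 := ((m1.const_mul u).add (m2.const_mul s)).add (m3.const_mul t)
      exact (Complex.measurable_exp.comp
        ((Complex.measurable_ofReal.comp m4).const_mul Complex.I)).aestronglyMeasurable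
    · rw [mul_comm, Complex.norm_exp_ofReal_mul_I]
    · filter_upwards [hν.ae_tendsto_value hK x, hν.ae_tendsto_value hK y] with φ hx hy
      have hc : Continuous fun r : ℝ => Complex.exp (Complex.I * (r : ℂ)) := by fun_prop
      exact (hc.tendsto _).comp (((hx.const_mul s).const_add (u * φ J)).add (hy.const_mul t))
  simp only [hν.charFun_comb hK] at h1
  refine tendsto_nhds_unique h1 ?_
  refine (Complex.continuous_ofReal.tendsto _).comp ((Real.continuous_exp.tendsto _).comp ?_)
  refine Tendsto.const_mul _ ?_
  have hx := hK.tendsto_covForm_bumpAt x x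
  have hy := hK.tendsto_covForm_bumpAt y y
  rw [sub_self] at hx hy
  exact ((((tendsto_const_nhds.add (hx.const_mul _)).add (hy.const_mul _)).add
    ((hK.tendsto_covForm_bumpAt_left x J).const_mul _)).add
    ((hK.tendsto_covForm_bumpAt_left y J).const_mul _)).add
    ((hK.tendsto_covForm_bumpAt x y).const_mul _)

end Field

/-! ### Limits of Gaussian expectations of measurable functions. -/

section GaussianLimits

/-- The expectation of `U` with respect to the normal law with mean `c` and variance one. -/
noncomputable def gaussMean (U : ℝ → ℝ) (c : ℝ) : ℝ := ∫ w, U w ∂(gaussianReal c 1)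

lemma gaussMean_eq (U : ℝ → ℝ) (c : ℝ) :
    gaussMean U c = 1 / √(2 * Real.pi) * ∫ w, U w * Real.exp (-(1 / 2) * (w - c) ^ 2) := by
  rw [gaussMean, integral_gaussianReal_eq_integral_smul one_ne_zero, ← integral_const_mul]
  congr 1 with w
  simp only [gaussianPDFReal, smul_eq_mul, NNReal.coe_one, mul_one]
  rw [show -(w - c) ^ 2 / 2 = -(1 / 2) * (w - c) ^ 2 by ring]
  ring

lemma abs_gaussMean_le {U : ℝ → ℝ} {M : ℝ} (hU : ∀ w, |U w| ≤ M) (c : ℝ) : |gaussMean U c| ≤ M := by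
  have := norm_integral_le_of_norm_le_const (μ := gaussianReal c 1) (f := U)
    (Eventually.of_forall hU)
  simpa [gaussMean] using this

/-- Moves `c` and `σ` out of the argument of `W`, which need not be continuous, into the density,
which depends on them smoothly. -/
lemma integral_affine_gaussian {W : ℝ → ℝ} (hW : Measurable W) {c σ : ℝ} (hσ : σ ≠ 0) :
    ∫ z, W (c + σ * z) ∂(gaussianReal 0 1)
      = ∫ w, gaussianPDFReal c (.mk (σ ^ 2) (sq_nonneg σ)) w * W w := by
  have hv : (.mk (σ ^ 2) (sq_nonneg σ) : NNReal) ≠ 0 := by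
    intro h
    exact hσ (pow_eq_zero_iff two_ne_zero |>.1 (congrArg NNReal.toReal h))
  have hm : gaussianReal c (.mk (σ ^ 2) (sq_nonneg σ)) = (gaussianReal 0 1).map fun z => c + σ *
      z := by
    have h1 := gaussianReal_map_const_mul (μ := 0) (v := 1) σ
    have h2 := gaussianReal_map_const_add (μ := σ * 0) (v := .mk (σ ^ 2) (sq_nonneg σ) * 1) c
    rw [← h1, Measure.map_map (by fun_prop) (by fun_prop)] at h2
    rw [mul_zero, zero_add, mul_one] at h2
    exact h2.symm
  have h3 := integral_gaussianReal_eq_integral_smul (μ := c) (f := W) hv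
  rw [hm, integral_map (by fun_prop) hW.aestronglyMeasurable] at h3
  simpa only [smul_eq_mul] using h3

lemma gaussianPDFReal_le {c c₀ σ : ℝ} (hc : |c - c₀| ≤ 1) (h1 : 1 / 2 ≤ σ) (h2 : σ ≤ 2) (w : ℝ) :
    gaussianPDFReal c (.mk (σ ^ 2) (sq_nonneg σ)) w
      ≤ (√(2 * Real.pi * (1 / 2) ^ 2))⁻¹ * Real.exp (1 / 8)
        * Real.exp (-(1 / 16) * (w - c₀) ^ 2) := by
  have hσ : 0 < σ := by linarith
  rw [gaussianPDFReal, mul_assoc (√(2 * Real.pi * (1 / 2) ^ 2))⁻¹, ← Real.exp_add]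
  simp only [NNReal.coe_mk]
  have h3 : (1 / 2 : ℝ) ^ 2 ≤ σ ^ 2 := by gcongr
  have h4 : σ ^ 2 ≤ 4 := by nlinarith
  -- The bound `σ ≤ 2` gives the exponent `-(w - c)²/8`; then `(w - c₀)² ≤ 2(w - c)² + 2(c - c₀)²`
  -- with `|c - c₀| ≤ 1`.
  have h5 : -(w - c) ^ 2 / (2 * σ ^ 2) ≤ 1 / 8 + -(1 / 16) * (w - c₀) ^ 2 := by
    have e1 : -(w - c) ^ 2 / (2 * σ ^ 2) ≤ -(w - c) ^ 2 / 8 := by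
      rw [neg_div, neg_div, neg_le_neg_iff]
      exact div_le_div_of_nonneg_left (sq_nonneg _) (by positivity) (by linarith)
    have e2 : (c - c₀) ^ 2 ≤ 1 := by
      rw [← sq_abs]
      exact pow_le_one₀ (abs_nonneg _) hc
    nlinarith [sq_nonneg ((w - c) - (c - c₀))]
  have hp : 0 < √(2 * Real.pi * (1 / 2) ^ 2) := Real.sqrt_pos.2 (by positivity)
  gcongr

variable {ι : Type*} {l : Filter ι} [l.IsCountablyGenerated] {W : ι → ℝ → ℝ} {U : ℝ → ℝ} {M : ℝ}

lemma tendsto_integral_affine_gaussian (hW : ∀ i, Measurable (W i)) (hM : ∀ i w, |W i w| ≤ M)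
    (hU : ∀ᵐ w, Tendsto (fun i => W i w) l (𝓝 (U w))) {c σ : ι → ℝ} {c₀ : ℝ}
    (hc : Tendsto c l (𝓝 c₀)) (hσ : Tendsto σ l (𝓝 1)) :
    Tendsto (fun i => ∫ z, W i (c i + σ i * z) ∂(gaussianReal 0 1)) l (𝓝 (gaussMean U c₀)) := by
  have hσ1 : ∀ᶠ i in l, 1 / 2 ≤ σ i ∧ σ i ≤ 2 :=
    (hσ.eventually (Icc_mem_nhds (by norm_num) (by norm_num) : Icc (1 / 2 : ℝ) 2 ∈ 𝓝 1)).mono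
      fun i hi => hi
  have hc1 : ∀ᶠ i in l, |c i - c₀| ≤ 1 :=
    (hc.eventually (Metric.closedBall_mem_nhds c₀ one_pos)).mono fun i hi => hi
  have e0 : gaussMean U c₀ = ∫ w, gaussianPDFReal c₀ 1 w * U w := by
    rw [gaussMean, integral_gaussianReal_eq_integral_smul one_ne_zero]
    rfl
  rw [e0]
  have hmain : Tendsto (fun i => ∫ w, gaussianPDFReal (c i) (.mk (σ i ^ 2) (sq_nonneg _)) w *
      W i w) l
      (𝓝 (∫ w, gaussianPDFReal c₀ 1 w * U w)) := by
    refine tendsto_integral_filter_of_dominated_convergence (fun w =>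
      (√(2 * Real.pi * (1 / 2) ^ 2))⁻¹ * Real.exp (1 / 8)
        * Real.exp (-(1 / 16) * (w - c₀) ^ 2) * M) (Eventually.of_forall fun i => ?_) ?_ ?_ ?_
    · exact ((measurable_gaussianPDFReal _ _).mul (hW i)).aestronglyMeasurable
    · filter_upwards [hσ1, hc1] with i h1 h2
      refine Eventually.of_forall fun w => ?_
      rw [norm_mul, Real.norm_eq_abs, Real.norm_eq_abs,
        abs_of_nonneg (gaussianPDFReal_nonneg _ _ _)]
      have hp := gaussianPDFReal_le h2 h1.1 h1.2 w
      gcongr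
      exact hM i w
    · have h0 := (integrable_exp_neg_mul_sq (show (0 : ℝ) < 1 / 16 by norm_num)).comp_sub_right c₀
      exact (h0.const_mul _).mul_const M
    · filter_upwards [hU] with w hw
      refine Tendsto.mul ?_ hw
      simp only [gaussianPDFReal, NNReal.coe_mk, NNReal.coe_one]
      have hσ2 : Tendsto (fun i => σ i ^ 2) l (𝓝 1) := by simpa using hσ.pow 2
      refine Tendsto.mul ?_ ?_
      · refine Tendsto.inv₀ ?_ (Real.sqrt_pos.2 (by positivity)).ne'
        exact (hσ2.const_mul _).sqrt
      · refine (Real.continuous_exp.tendsto _).comp ?_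
        refine Tendsto.div ?_ (hσ2.const_mul _) (by norm_num)
        exact ((hc.const_sub w).pow 2).neg
  refine hmain.congr' ?_
  filter_upwards [hσ1] with i hi
  rw [integral_affine_gaussian (hW i) (by linarith [hi.1] : σ i ≠ 0)]

lemma tendsto_integral_prod_fst (hW : ∀ i, Measurable (W i)) (hM : ∀ i w, |W i w| ≤ M)
    (hU : ∀ᵐ w, Tendsto (fun i => W i w) l (𝓝 (U w))) {a : ι → ℝ} {a₀ : ℝ}
    (ha : Tendsto a l (𝓝 a₀)) :
    Tendsto (fun i => ∫ p, W i (p.1 + a i) ∂((gaussianReal 0 1).prod (gaussianReal 0 1))) l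
      (𝓝 (gaussMean U a₀)) := by
  have h := tendsto_integral_affine_gaussian hW hM hU ha tendsto_const_nhds
  refine h.congr fun i => ?_
  rw [integral_fun_fst (fun z => W i (z + a i))]
  simp [add_comm]

/-- Asymptotic independence: for a fixed first variable `z`, the inner expectation `G i z` tends to
a limit that no longer depends on `z`, because the correlation vanishes. -/
lemma tendsto_integral_prod_mul [l.NeBot] (hW : ∀ i, Measurable (W i)) (hM : ∀ i w, |W i w| ≤ M)
    (hU : ∀ᵐ w, Tendsto (fun i => W i w) l (𝓝 (U w))) {a b r : ι → ℝ} {a₀ b₀ : ℝ}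
    (ha : Tendsto a l (𝓝 a₀)) (hb : Tendsto b l (𝓝 b₀)) (hr : Tendsto r l (𝓝 0)) :
    Tendsto (fun i => ∫ p, W i (p.1 + a i) * W i (r i * p.1 + b i + √(1 - r i ^ 2) * p.2)
      ∂((gaussianReal 0 1).prod (gaussianReal 0 1))) l
      (𝓝 (gaussMean U a₀ * gaussMean U b₀)) := by
  have hM0 : 0 ≤ M := by
    obtain ⟨i⟩ : Nonempty ι := l.nonempty_of_neBot
    exact (abs_nonneg _).trans (hM i 0)
  have hσ : Tendsto (fun i => √(1 - r i ^ 2)) l (𝓝 1) := by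
    have : Tendsto (fun i => 1 - r i ^ 2) l (𝓝 1) := by simpa using (hr.pow 2).const_sub 1
    simpa using this.sqrt
  set γ := gaussianReal 0 1
  set G : ι → ℝ → ℝ := fun i z => ∫ z', W i (r i * z + b i + √(1 - r i ^ 2) * z') ∂γ with hG
  have hGm : ∀ i, Measurable (G i) := by
    intro i
    have : Measurable fun p : ℝ × ℝ => W i (r i * p.1 + b i + √(1 - r i ^ 2) * p.2) :=
      (hW i).comp (by fun_prop)
    exact this.stronglyMeasurable.integral_prod_right.measurable
  have hGb : ∀ i z, |G i z| ≤ M := by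
    intro i z
    have := norm_integral_le_of_norm_le_const (μ := γ)
      (f := fun z' => W i (r i * z + b i + √(1 - r i ^ 2) * z'))
        (Eventually.of_forall fun _ => hM i _)
    simpa [hG] using this
  have hGl : ∀ z, Tendsto (fun i => G i z) l (𝓝 (gaussMean U b₀)) := by
    intro z
    refine tendsto_integral_affine_gaussian hW hM hU ?_ hσ
    simpa using (hr.mul_const z).add hb
  have e1 : ∀ i, ∫ p, W i (p.1 + a i) * W i (r i * p.1 + b i + √(1 - r i ^ 2) * p.2) ∂(γ.prod γ)
      = ∫ z, W i (z + a i) * G i z ∂γ := by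
    intro i
    rw [integral_prod]
    · simp only [hG, integral_const_mul]
    · refine Integrable.of_bound (C := M * M) (Measurable.aestronglyMeasurable ?_)
        (Eventually.of_forall fun p => ?_)
      · exact ((hW i).comp (by fun_prop)).mul ((hW i).comp (by fun_prop))
      · rw [norm_mul]
        exact mul_le_mul (hM _ _) (hM _ _) (norm_nonneg _) hM0
  simp only [e1]
  have hWi : ∀ i, Integrable (fun z => W i (z + a i)) γ := fun i =>
    Integrable.of_bound (C := M) ((hW i).comp (by fun_prop)).aestronglyMeasurable
      (Eventually.of_forall fun p => hM _ _)
  have hWGi : ∀ i, Integrable (fun z => W i (z + a i) * (G i z - gaussMean U b₀)) γ := fun i =>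
    (hWi i).mul_bdd (c := M + |gaussMean U b₀|) ((hGm i).sub_const _).aestronglyMeasurable
      (Eventually.of_forall fun z => (norm_sub_le _ _).trans (by
        rw [Real.norm_eq_abs, Real.norm_eq_abs]; gcongr; exact hGb i z))
  -- The factor `W i (z + a i)` need not converge pointwise, so the constant limit of `G` is split
  -- off before dominated convergence is applied.
  have e2 : ∀ i, ∫ z, W i (z + a i) * G i z ∂γ
      = (∫ z, W i (z + a i) * (G i z - gaussMean U b₀) ∂γ)
        + (∫ z, W i (z + a i) ∂γ) * gaussMean U b₀ := by
    intro i
    rw [← integral_mul_const, ← integral_add (hWGi i) ((hWi i).mul_const _)]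
    congr 1 with z
    ring
  simp only [e2]
  have t1 : Tendsto (fun i => ∫ z, W i (z + a i) * (G i z - gaussMean U b₀) ∂γ) l (𝓝 0) := by
    have := tendsto_integral_filter_of_dominated_convergence (μ := γ) (l := l)
      (F := fun i z => W i (z + a i) * (G i z - gaussMean U b₀)) (f := fun _ => 0)
      (fun _ => M * (M + |gaussMean U b₀|))
      (Eventually.of_forall fun i => (hWGi i).aestronglyMeasurable)
      (Eventually.of_forall fun i => Eventually.of_forall fun z => by
        rw [norm_mul]
        refine mul_le_mul (hM _ _) ((norm_sub_le _ _).trans ?_) (norm_nonneg _) hM0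
        rw [Real.norm_eq_abs, Real.norm_eq_abs]
        gcongr
        exact hGb i z)
      (integrable_const _)
      (Eventually.of_forall fun z => by
        refine squeeze_zero_norm (a := fun i => M * |G i z - gaussMean U b₀|) (fun i => ?_) ?_
        · rw [norm_mul]
          exact mul_le_mul_of_nonneg_right (hM _ _) (norm_nonneg _)
        · have := ((hGl z).sub_const (gaussMean U b₀)).abs.const_mul M
          simpa using this)
    simpa using this
  have t2 : Tendsto (fun i => ∫ z, W i (z + a i) ∂γ) l (𝓝 (gaussMean U a₀)) := by
    have h := tendsto_integral_affine_gaussian hW hM hU ha tendsto_const_nhds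
    refine h.congr fun i => ?_
    simp [add_comm, γ]
  simpa using t1.add (t2.mul_const (gaussMean U b₀))

end GaussianLimits

/-! ### The free covariance as a proper-time integral of heat kernels. -/

section HeatKernel

variable {d : ℕ} {m : ℝ}

/-- The massive heat kernel `(4 π t)^{-d/2} e^{-m² t - |x|² / 4t}`. -/
noncomputable def heat (d : ℕ) (m t : ℝ) (x : Space d) : ℝ :=
  Real.exp (-(t * m ^ 2)) * (4 * Real.pi * t) ^ (-(d / 2 : ℝ)) * Real.exp (-‖x‖ ^ 2 / (4 * t))

lemma heat_pos {t : ℝ} (ht : 0 < t) (x : Space d) : 0 < heat d m t x := by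
  have := Real.pi_pos
  unfold heat
  positivity

lemma heat_zero (t : ℝ) : heat d m t 0 = Real.exp (-(t * m ^ 2)) * (4 * Real.pi * t) ^
    (-(d / 2 : ℝ)) := by
  simp [heat]

lemma heat_eq (t : ℝ) (x : Space d) :
    heat d m t x = heat d m t 0 * Real.exp (-‖x‖ ^ 2 / (4 * t)) := by
  rw [heat_zero, heat]

lemma heat_le {t : ℝ} (ht : 0 < t) (x : Space d) : heat d m t x ≤ heat d m t 0 := by
  rw [heat_eq]
  refine mul_le_of_le_one_right (heat_pos ht 0).le ?_
  rw [Real.exp_le_one_iff]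
  exact div_nonpos_of_nonpos_of_nonneg (by simp) (by positivity)

lemma measurable_heat : Measurable fun p : ℝ × Space d => heat d m p.1 p.2 := by
  unfold heat
  fun_prop

lemma measurable_heat_left (x : Space d) : Measurable fun t => heat d m t x := by
  unfold heat
  fun_prop

lemma integrableOn_exp_mass (hm : 0 < m) (a : ℝ) :
    IntegrableOn (fun t => Real.exp (-(t * m ^ 2))) (Ioi a) := by
  have := integrableOn_exp_mul_Ioi (a := -m ^ 2) (by have := pow_pos hm 2; linarith) a
  refine this.congr_fun (fun t _ => ?_) measurableSet_Ioi
  simp only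
  congr 1
  ring

lemma heat_zero_le {τ t : ℝ} (hτ : 0 < τ) (ht : τ ≤ t) :
    heat d m t 0 ≤ (4 * Real.pi * τ) ^ (-(d / 2 : ℝ)) * Real.exp (-(t * m ^ 2)) := by
  rw [heat_zero, mul_comm]
  have hpi := Real.pi_pos
  refine mul_le_mul_of_nonneg_right ?_ (Real.exp_pos _).le
  exact Real.rpow_le_rpow_of_nonpos (by positivity) (by gcongr)
    (by have : (0 : ℝ) ≤ d / 2 := by positivity
        linarith)

lemma integrableOn_heat (hm : 0 < m) {τ : ℝ} (hτ : 0 < τ) (x : Space d) :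
    IntegrableOn (fun t => heat d m t x) (Ioi τ) := by
  refine Integrable.mono' ((integrableOn_exp_mass hm τ).const_mul ((4 * Real.pi * τ) ^
    (-(d / 2 : ℝ))))
    (measurable_heat_left x).aestronglyMeasurable ?_
  filter_upwards [ae_restrict_mem measurableSet_Ioi] with t ht
  have ht0 : 0 < t := hτ.trans ht
  rw [Real.norm_eq_abs, abs_of_pos (heat_pos ht0 x)]
  exact (heat_le ht0 x).trans (heat_zero_le hτ (le_of_lt ht))

lemma integral_exp_laplace {s τ : ℝ} (hs : 0 < s) :
    ∫ t in Ioi τ, Real.exp (-(t * s)) = Real.exp (-(τ * s)) / s := by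
  have := integral_exp_mul_Ioi (a := -s) (by linarith) τ
  simp only [neg_mul, mul_comm s] at this
  rw [this, neg_div_neg_eq]

lemma rpow_gaussian_const {t : ℝ} (ht : 0 < t) :
    (Real.pi / t) ^ (d / 2 : ℝ) / (2 * Real.pi) ^ d = (4 * Real.pi * t) ^ (-(d / 2 : ℝ)) := by
  have hpi := Real.pi_pos
  have h1 : (2 * Real.pi) ^ d = ((2 * Real.pi) ^ 2) ^ (d / 2 : ℝ) := by
    rw [← Real.rpow_natCast (2 * Real.pi) 2, ← Real.rpow_mul (by positivity), ← Real.rpow_natCast]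
    congr 1
    push_cast
    ring
  rw [h1, ← Real.div_rpow (by positivity) (by positivity), Real.rpow_neg (by positivity),
    ← Real.inv_rpow (by positivity)]
  congr 1
  field_simp
  ring

lemma integral_gaussian_space {t : ℝ} (ht : 0 < t) :
    ∫ p : Space d, Real.exp (-t * ‖p‖ ^ 2) = (Real.pi / t) ^ (d / 2 : ℝ) := by
  rw [GaussianFourier.integral_rexp_neg_mul_sq_norm ht]
  simp

lemma integrable_gaussian_space {t : ℝ} (ht : 0 < t) :
    Integrable fun p : Space d => Real.exp (-t * ‖p‖ ^ 2) := by
  -- A nonintegrable function has Bochner integral zero, while the value computed above is positive.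
  by_contra h
  have h1 := integral_gaussian_space (d := d) ht
  rw [integral_undef h] at h1
  have hpi := Real.pi_pos
  have : 0 < (Real.pi / t) ^ (d / 2 : ℝ) := by positivity
  linarith

lemma integral_fourier_gaussian {t : ℝ} (ht : 0 < t) (x : Space d) :
    ∫ p : Space d, Complex.exp (Complex.I * (inner ℝ p x : ℝ)) *
      ((Real.exp (-(t * (‖p‖ ^ 2 + m ^ 2))) / (2 * Real.pi) ^ d : ℝ) : ℂ) = (heat d m t x : ℂ) := by
  have h := GaussianFourier.integral_cexp_neg_mul_sq_norm_add (V := Space d) (b := t) (by simpa)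
      Complex.I x
  have e : ∀ p : Space d, Complex.exp (Complex.I * (inner ℝ p x : ℝ)) *
      ((Real.exp (-(t * (‖p‖ ^ 2 + m ^ 2))) / (2 * Real.pi) ^ d : ℝ) : ℂ)
      = ((Real.exp (-(t * m ^ 2)) / (2 * Real.pi) ^ d : ℝ) : ℂ)
        * Complex.exp (-t * ‖p‖ ^ 2 + Complex.I * (inner ℝ x p : ℝ)) := by
    intro p
    rw [real_inner_comm]
    push_cast
    rw [mul_add, neg_add, Complex.exp_add, Complex.exp_add]
    ring_nf
  simp only [e]
  rw [integral_const_mul, h]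
  have hpi := Real.pi_pos
  have h2 : ((Real.pi : ℂ) / t) ^ ((Module.finrank ℝ (Space d) : ℂ) / 2)
      = (((Real.pi / t) ^ (d / 2 : ℝ) : ℝ) : ℂ) := by
    rw [Complex.ofReal_cpow (by positivity)]
    simp
  rw [h2, heat, ← rpow_gaussian_const ht]
  push_cast
  rw [Complex.I_sq]
  ring_nf

/-- Justifies Fubini in the proper-time formula: the absolute value integrates over momenta to the
heat kernel at the origin, which is integrable in `t` away from zero. -/
lemma integrable_laplace_gaussian (hm : 0 < m) {τ : ℝ} (hτ : 0 < τ) (x : Space d) :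
    Integrable (fun q : ℝ × Space d => Complex.exp (Complex.I * (inner ℝ q.2 x : ℝ)) *
      ((Real.exp (-(q.1 * (‖q.2‖ ^ 2 + m ^ 2))) / (2 * Real.pi) ^ d : ℝ) : ℂ))
      ((volume.restrict (Ioi τ)).prod volume) := by
  have hpi := Real.pi_pos
  have hn : ∀ (t : ℝ) (p : Space d), ‖Complex.exp (Complex.I * (inner ℝ p x : ℝ)) *
      ((Real.exp (-(t * (‖p‖ ^ 2 + m ^ 2))) / (2 * Real.pi) ^ d : ℝ) : ℂ)‖
      = Real.exp (-(t * m ^ 2)) / (2 * Real.pi) ^ d * Real.exp (-t * ‖p‖ ^ 2) := by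
    intro t p
    rw [norm_mul, mul_comm Complex.I, Complex.norm_exp_ofReal_mul_I, one_mul, Complex.norm_real,
      Real.norm_eq_abs, abs_of_pos (by positivity), div_mul_eq_mul_div, ← Real.exp_add]
    congr 2
    ring
  have hmeas : Measurable fun q : ℝ × Space d => Complex.exp (Complex.I * (inner ℝ q.2 x : ℝ)) *
      ((Real.exp (-(q.1 * (‖q.2‖ ^ 2 + m ^ 2))) / (2 * Real.pi) ^ d : ℝ) : ℂ) := by
    refine Continuous.measurable ?_
    fun_prop
  rw [integrable_prod_iff hmeas.aestronglyMeasurable]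
  refine ⟨?_, ?_⟩
  · filter_upwards [ae_restrict_mem measurableSet_Ioi] with t ht
    have ht0 : 0 < t := hτ.trans ht
    refine Integrable.mono' ((integrable_gaussian_space ht0).const_mul
      (Real.exp (-(t * m ^ 2)) / (2 * Real.pi) ^ d))
      (hmeas.comp measurable_prodMk_left).aestronglyMeasurable
      (Eventually.of_forall fun p => (hn t p).le)
  · refine (integrableOn_heat (d := d) hm hτ 0).congr_fun (fun t ht => ?_) measurableSet_Ioi
    have ht0 : 0 < t := hτ.trans ht
    simp only [hn]
    rw [integral_const_mul, integral_gaussian_space ht0, heat_zero, ← rpow_gaussian_const ht0]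
    ring

/-- Integrating `e^{-t(p² + m²)}` over `t > 1/Λ²` produces exactly the regularized propagator, so
the cut-off truncates proper time. Positivity, the maximum at the origin and monotonicity in `Λ` can
then be read off the heat kernel. -/
lemma covCutoff_eq (hm : 0 < m) {Λ : ℝ} (hΛ : 0 < Λ) (x : Space d) :
    covCutoff d m Λ x = ∫ t in Ioi (1 / Λ ^ 2), heat d m t x := by
  have hτ : 0 < 1 / Λ ^ 2 := by positivity
  have e : ∀ p : Space d, Complex.exp (Complex.I * (inner ℝ p x : ℝ)) *
      ((Real.exp (-(‖p‖ ^ 2 + m ^ 2) / Λ ^ 2) / (‖p‖ ^ 2 + m ^ 2) / (2 * Real.pi) ^ d : ℝ) : ℂ)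
      = ∫ t in Ioi (1 / Λ ^ 2), Complex.exp (Complex.I * (inner ℝ p x : ℝ)) *
        ((Real.exp (-(t * (‖p‖ ^ 2 + m ^ 2))) / (2 * Real.pi) ^ d : ℝ) : ℂ) := by
    intro p
    have hs : 0 < ‖p‖ ^ 2 + m ^ 2 := by positivity
    rw [integral_const_mul, integral_complex_ofReal, integral_div, integral_exp_laplace hs]
    congr 5
    ring
  rw [covCutoff]
  simp only [e]
  rw [← integral_integral_swap (integrable_laplace_gaussian hm hτ x)]
  rw [setIntegral_congr_fun measurableSet_Ioi
    (fun t ht => integral_fourier_gaussian (hτ.trans ht) x), integral_complex_ofReal,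
      Complex.ofReal_re]

lemma covCutoff_nonneg (hm : 0 < m) {Λ : ℝ} (hΛ : 0 < Λ) (x : Space d) : 0 ≤ covCutoff d m Λ x := by
  rw [covCutoff_eq hm hΛ]
  exact setIntegral_nonneg measurableSet_Ioi fun t ht =>
    (heat_pos (lt_trans (by positivity) ht) x).le

lemma covCutoff_pos (hm : 0 < m) {Λ : ℝ} (hΛ : 0 < Λ) (x : Space d) : 0 < covCutoff d m Λ x := by
  refine (covCutoff_nonneg hm hΛ x).lt_of_ne' fun h => ?_
  have hτ : 0 < 1 / Λ ^ 2 := by positivity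
  rw [covCutoff_eq hm hΛ, setIntegral_eq_zero_iff_of_nonneg_ae ?_ (integrableOn_heat hm hτ x)] at h
  · have h2 : ∀ᵐ t ∂(volume.restrict (Ioi (1 / Λ ^ 2))), False := by
      filter_upwards [h, ae_restrict_mem measurableSet_Ioi] with t h1 h2
      exact (heat_pos (hτ.trans h2) x).ne' h1
    rw [eventually_false_iff_eq_bot, ae_eq_bot, Measure.restrict_eq_zero] at h2
    simp at h2
  · filter_upwards [ae_restrict_mem measurableSet_Ioi] with t ht
    exact (heat_pos (hτ.trans ht) x).le

lemma covCutoff_le_zero (hm : 0 < m) {Λ : ℝ} (hΛ : 0 < Λ) (x : Space d) :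
    covCutoff d m Λ x ≤ covCutoff d m Λ 0 := by
  have hτ : 0 < 1 / Λ ^ 2 := by positivity
  rw [covCutoff_eq hm hΛ, covCutoff_eq hm hΛ]
  exact setIntegral_mono_on (integrableOn_heat hm hτ x) (integrableOn_heat hm hτ 0)
    measurableSet_Ioi fun t ht => heat_le (hτ.trans ht) x

lemma isRegularKernel_covCutoff (hm : 0 < m) {Λ : ℝ} (hΛ : 0 < Λ) :
    IsRegularKernel (covCutoff d m Λ) where
  continuous := by
    have hτ : 0 < 1 / Λ ^ 2 := by positivity
    have e : covCutoff d m Λ = fun x => ∫ t in Ioi (1 / Λ ^ 2), heat d m t x :=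
      funext (covCutoff_eq hm hΛ)
    rw [e]
    refine continuous_of_dominated (bound := fun t => heat d m t 0)
      (fun x => (measurable_heat_left x).aestronglyMeasurable) (fun x => ?_)
      (integrableOn_heat hm hτ 0) (Eventually.of_forall fun t => ?_)
    · filter_upwards [ae_restrict_mem measurableSet_Ioi] with t ht
      rw [Real.norm_eq_abs, abs_of_pos (heat_pos (hτ.trans ht) x)]
      exact heat_le (hτ.trans ht) x
    · unfold heat
      fun_prop
  bounded := ⟨covCutoff d m Λ 0, fun x => by
    rw [abs_of_nonneg (covCutoff_nonneg hm hΛ x)]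
    exact covCutoff_le_zero hm hΛ x⟩
  even x := by simp only [covCutoff_eq hm hΛ, heat, norm_neg]
  quadratic := by
    have hτ : 0 < 1 / Λ ^ 2 := by positivity
    refine ⟨covCutoff d m Λ 0 / (4 * (1 / Λ ^ 2)),
      div_nonneg (covCutoff_nonneg hm hΛ 0) (by positivity), fun x => ?_⟩
    rw [abs_sub_comm, abs_of_nonneg (sub_nonneg.2 (covCutoff_le_zero hm hΛ x)),
      covCutoff_eq hm hΛ, covCutoff_eq hm hΛ,
      ← integral_sub (integrableOn_heat hm hτ 0) (integrableOn_heat hm hτ x), ← integral_div,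
      ← integral_mul_const]
    refine setIntegral_mono_on ((integrableOn_heat hm hτ 0).sub (integrableOn_heat hm hτ x))
      (((integrableOn_heat hm hτ 0).div_const _).mul_const _) measurableSet_Ioi fun t ht => ?_
    have ht0 : 0 < t := hτ.trans ht
    rw [heat_eq t x]
    -- The quadratic bound rests on `1 - e^{-s} ≤ s` together with `t ≥ 1/Λ²`.
    have h1 : 1 - Real.exp (-‖x‖ ^ 2 / (4 * t)) ≤ ‖x‖ ^ 2 / (4 * t) := by
      have := Real.add_one_le_exp (-‖x‖ ^ 2 / (4 * t))
      rw [neg_div] at this ⊢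
      linarith
    have h2 : ‖x‖ ^ 2 / (4 * t) ≤ ‖x‖ ^ 2 / (4 * (1 / Λ ^ 2)) := by
      have : 1 / Λ ^ 2 ≤ t := le_of_lt ht
      gcongr
    calc heat d m t 0 - heat d m t 0 * Real.exp (-‖x‖ ^ 2 / (4 * t))
        = heat d m t 0 * (1 - Real.exp (-‖x‖ ^ 2 / (4 * t))) := by ring
      _ ≤ heat d m t 0 * (‖x‖ ^ 2 / (4 * (1 / Λ ^ 2))) :=
        mul_le_mul_of_nonneg_left (h1.trans h2) (heat_pos ht0 0).le
      _ = _ := by ring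

lemma IsRegularKernel.const_mul {K : Space d → ℝ} (hK : IsRegularKernel K) (c : ℝ) :
    IsRegularKernel fun x => c * K x where
  continuous := hK.continuous.const_mul c
  bounded := by
    obtain ⟨M, hM⟩ := hK.bounded
    exact ⟨|c| * M, fun x => by rw [abs_mul]; gcongr; exact hM x⟩
  even x := by rw [hK.even]
  quadratic := by
    obtain ⟨A, hA, h⟩ := hK.quadratic
    refine ⟨|c| * A, by positivity, fun x => ?_⟩
    rw [← mul_sub, abs_mul, mul_assoc]
    gcongr
    exact h x

lemma tendsto_one_div_sq : Tendsto (fun Λ : ℝ => 1 / Λ ^ 2) atTop (𝓝 0) :=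
  (tendsto_pow_atTop (two_ne_zero)).const_div_atTop 1

/-- The dimension enters here: at the origin the heat kernel behaves like `t^{-d/2}`, which
dominates `1/t` on `(0, 1]`, so the integral grows at least like `log Λ²`. -/
lemma tendsto_covCutoff_zero (hd : 2 ≤ d) (hm : 0 < m) :
    Tendsto (fun Λ => covCutoff d m Λ 0) atTop atTop := by
  have hpi := Real.pi_pos
  set c : ℝ := Real.exp (-(m ^ 2)) * (4 * Real.pi) ^ (-(d / 2 : ℝ)) with hc
  have hcpos : 0 < c := by positivity
  have hlog : Tendsto (fun Λ : ℝ => c * (2 * Real.log Λ)) atTop atTop :=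
    (Real.tendsto_log_atTop.const_mul_atTop two_pos).const_mul_atTop hcpos
  refine tendsto_atTop_mono' atTop ?_ hlog
  filter_upwards [eventually_ge_atTop 1] with Λ hΛ1
  have hΛ : 0 < Λ := by linarith
  have hτ : 0 < 1 / Λ ^ 2 := by positivity
  have hτ1 : 1 / Λ ^ 2 ≤ 1 := by
    rw [div_le_one (by positivity)]
    exact one_le_pow₀ hΛ1
  rw [covCutoff_eq hm hΛ]
  have hlow : ∀ t ∈ Ioc (1 / Λ ^ 2) 1, c * t⁻¹ ≤ heat d m t 0 := by
    intro t ht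
    have ht0 : 0 < t := hτ.trans ht.1
    rw [heat_zero, Real.mul_rpow (by positivity) ht0.le, hc, ← mul_assoc]
    have h1 : Real.exp (-(m ^ 2)) ≤ Real.exp (-(t * m ^ 2)) := by
      rw [Real.exp_le_exp, neg_le_neg_iff]
      exact mul_le_of_le_one_left (sq_nonneg m) ht.2
    have h2 : t⁻¹ ≤ t ^ (-(d / 2 : ℝ)) := by
      rw [← Real.rpow_neg_one]
      refine Real.rpow_le_rpow_of_exponent_ge ht0 ht.2 ?_
      have : (2 : ℝ) ≤ d := by exact_mod_cast hd
      linarith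
    gcongr
  have hint : IntegrableOn (fun t : ℝ => c * t⁻¹) (Ioc (1 / Λ ^ 2) 1) := by
    have : IntervalIntegrable (fun t : ℝ => t⁻¹) volume (1 / Λ ^ 2) 1 :=
      intervalIntegral.intervalIntegrable_inv (fun t ht => by
        rw [uIcc_of_le hτ1] at ht
        exact (hτ.trans_le ht.1).ne') continuousOn_id
    exact ((intervalIntegrable_iff_integrableOn_Ioc_of_le hτ1).1 this).const_mul c
  calc c * (2 * Real.log Λ) = ∫ t in Ioc (1 / Λ ^ 2) 1, c * t⁻¹ := by
        rw [← intervalIntegral.integral_of_le hτ1, intervalIntegral.integral_const_mul,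
          integral_inv_of_pos hτ one_pos]
        congr 1
        rw [one_div_one_div, Real.log_pow]
        push_cast
        ring
    _ ≤ ∫ t in Ioc (1 / Λ ^ 2) 1, heat d m t 0 :=
        setIntegral_mono_on hint ((integrableOn_heat hm hτ 0).mono_set Ioc_subset_Ioi_self)
          measurableSet_Ioc hlow
    _ ≤ ∫ t in Ioi (1 / Λ ^ 2), heat d m t 0 := by
        refine setIntegral_mono_set (integrableOn_heat hm hτ 0) ?_
          (Ioc_subset_Ioi_self.eventuallyLE)
        filter_upwards [ae_restrict_mem measurableSet_Ioi] with t ht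
        exact (heat_pos (hτ.trans ht) 0).le

lemma integral_heat_space {t : ℝ} (ht : 0 < t) :
    Integrable (fun x : Space d => heat d m t x) ∧
      ∫ x : Space d, heat d m t x = Real.exp (-(t * m ^ 2)) := by
  have hpi := Real.pi_pos
  have ht' : 0 < 1 / (4 * t) := by positivity
  have e : (fun x : Space d => heat d m t x)
      = fun x => heat d m t 0 * Real.exp (-(1 / (4 * t)) * ‖x‖ ^ 2) := by
    funext x
    rw [heat_eq]
    congr 2
    ring
  rw [e]
  refine ⟨(integrable_gaussian_space ht').const_mul _, ?_⟩
  rw [integral_const_mul, integral_gaussian_space ht', heat_zero, mul_assoc,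
    Real.rpow_neg (by positivity)]
  rw [show Real.pi / (1 / (4 * t)) = 4 * Real.pi * t by field_simp,
    inv_mul_cancel₀ (by positivity), mul_one]

/-- The total mass of the heat kernel at time `t` is `e^{-tm²}`, integrable on the half line. Fubini
then gives at once that `C` is finite almost everywhere and integrable. -/
lemma integrable_heat_prod (hm : 0 < m) :
    Integrable (fun q : ℝ × Space d => heat d m q.1 q.2)
      ((volume.restrict (Ioi 0)).prod volume) := by
  rw [integrable_prod_iff measurable_heat.aestronglyMeasurable]
  refine ⟨?_, ?_⟩
  · filter_upwards [ae_restrict_mem measurableSet_Ioi] with t ht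
    exact (integral_heat_space ht).1
  · refine (integrableOn_exp_mass hm 0).congr_fun (fun t ht => ?_) measurableSet_Ioi
    simp only
    rw [← (integral_heat_space (d := d) ht).2]
    congr 1 with x
    rw [Real.norm_eq_abs, abs_of_pos (heat_pos ht x)]

lemma ae_integrableOn_heat (hm : 0 < m) :
    ∀ᵐ x : Space d, IntegrableOn (fun t => heat d m t x) (Ioi 0) :=
  (integrable_heat_prod hm).prod_left_ae

lemma ae_tendsto_covCutoff (hm : 0 < m) :
    ∀ᵐ x : Space d, Tendsto (fun Λ => covCutoff d m Λ x) atTop (𝓝 (∫ t in Ioi 0, heat d m t x)) :=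
        by
  filter_upwards [ae_integrableOn_heat (d := d) hm] with x hx
  have h1 : Tendsto (fun Λ : ℝ => ∫ t in Ioi 0, (Ioi (1 / Λ ^ 2)).indicator
      (fun t => heat d m t x) t)
      atTop (𝓝 (∫ t in Ioi 0, heat d m t x)) := by
    refine tendsto_integral_filter_of_dominated_convergence (fun t => ‖heat d m t x‖)
      (Eventually.of_forall fun Λ =>
        ((measurable_heat_left x).indicator measurableSet_Ioi).aestronglyMeasurable)
      (Eventually.of_forall fun Λ => Eventually.of_forall fun t => norm_indicator_le_norm_self _ _)
      hx.norm ?_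
    filter_upwards [ae_restrict_mem measurableSet_Ioi] with t ht
    refine tendsto_const_nhds.congr' ?_
    filter_upwards [tendsto_one_div_sq.eventually (gt_mem_nhds ht)] with Λ hΛ
    rw [indicator_of_mem (mem_Ioi.2 hΛ)]
  refine h1.congr' ?_
  filter_upwards [eventually_gt_atTop 0] with Λ hΛ
  have hτ : 0 < 1 / Λ ^ 2 := by positivity
  rw [covCutoff_eq hm hΛ, setIntegral_indicator measurableSet_Ioi,
    inter_eq_right.2 (Ioi_subset_Ioi hτ.le)]

lemma cov_ae_eq (hm : 0 < m) : ∀ᵐ x : Space d, cov d m x = ∫ t in Ioi 0, heat d m t x :=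
  (ae_tendsto_covCutoff hm).mono fun _ hx => hx.limUnder_eq

lemma ae_tendsto_cov (hm : 0 < m) :
    ∀ᵐ x : Space d, Tendsto (fun Λ => covCutoff d m Λ x) atTop (𝓝 (cov d m x)) := by
  filter_upwards [ae_tendsto_covCutoff (d := d) hm, cov_ae_eq (d := d) hm] with x h1 h2
  rwa [h2]

lemma integrable_cov (hm : 0 < m) : Integrable (cov d m) :=
  (integrable_heat_prod hm).integral_prod_right.congr ((cov_ae_eq hm).mono fun _ h => h.symm)

/-- One null set serves all cut-offs, so `C` is an integrable majorant of every `C_Λ`. -/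
lemma ae_covCutoff_le_cov (hm : 0 < m) :
    ∀ᵐ x : Space d, ∀ Λ : ℝ, 0 < Λ → covCutoff d m Λ x ≤ cov d m x := by
  filter_upwards [cov_ae_eq (d := d) hm, ae_integrableOn_heat (d := d) hm] with x h1 h2 Λ hΛ
  have hτ : 0 < 1 / Λ ^ 2 := by positivity
  rw [h1, covCutoff_eq hm hΛ]
  refine setIntegral_mono_set h2 ?_ (Ioi_subset_Ioi hτ.le).eventuallyLE
  filter_upwards [ae_restrict_mem measurableSet_Ioi] with t ht
  exact (heat_pos ht x).le

lemma ae_cov_pos (hm : 0 < m) : ∀ᵐ x : Space d, 0 < cov d m x := by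
  filter_upwards [ae_covCutoff_le_cov (d := d) hm] with x hx
  exact (covCutoff_pos hm one_pos x).trans_le (hx 1 one_pos)

lemma ae_comp_sub_left {p : Space d → Prop} (h : ∀ᵐ u, p u) (x : Space d) : ∀ᵐ y, p (x - y) :=
  (quasiMeasurePreserving_sub_left volume x).ae h

lemma schwartz_bounded (J : 𝓢(Space d, ℝ)) : ∃ M, 0 ≤ M ∧ ∀ x, |J x| ≤ M :=
  ⟨SchwartzMap.seminorm ℝ 0 0 J, apply_nonneg _ _, fun x => J.norm_le_seminorm ℝ x⟩

lemma tendsto_smear (hm : 0 < m) (J : 𝓢(Space d, ℝ)) (x : Space d) :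
    Tendsto (fun Λ => smear (covCutoff d m Λ) J x) atTop (𝓝 (smear (cov d m) J x)) := by
  obtain ⟨M, hM0, hM⟩ := schwartz_bounded J
  refine tendsto_integral_filter_of_dominated_convergence (fun y => cov d m (x - y) * M) ?_ ?_
    (((integrable_cov hm).comp_sub_left x).mul_const M) ?_
  · filter_upwards [eventually_gt_atTop 0] with Λ hΛ
    exact ((isRegularKernel_covCutoff hm hΛ).integrable_mul J x).aestronglyMeasurable
  · filter_upwards [eventually_gt_atTop 0] with Λ hΛ
    filter_upwards [ae_comp_sub_left (ae_covCutoff_le_cov hm) x] with y hy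
    rw [norm_mul, Real.norm_eq_abs, abs_of_nonneg (covCutoff_nonneg hm hΛ _)]
    exact mul_le_mul (hy Λ hΛ) (hM y) (norm_nonneg _) ((covCutoff_nonneg hm hΛ _).trans (hy Λ hΛ))
  · filter_upwards [ae_comp_sub_left (ae_tendsto_cov hm) x] with y hy
    exact hy.mul_const _

lemma measurable_smear_cov (hm : 0 < m) (J : 𝓢(Space d, ℝ)) : Measurable (smear (cov d m) J) := by
  refine measurable_of_tendsto_metrizable
    (f := fun (n : ℕ) x => smear (covCutoff d m ((n : ℝ) + 1)) J x) (fun n => ?_) ?_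
  · exact ((isRegularKernel_covCutoff hm (by positivity)).continuous_smear J).measurable
  · rw [tendsto_pi_nhds]
    intro x
    exact (tendsto_smear hm J x).comp
      (tendsto_atTop_add_const_right _ _ tendsto_natCast_atTop_atTop)

lemma smear_cov_bounded (hm : 0 < m) (J : 𝓢(Space d, ℝ)) :
    ∃ M, ∀ x, |smear (cov d m) J x| ≤ M := by
  obtain ⟨M, hM0, hM⟩ := schwartz_bounded J
  refine ⟨(∫ u, cov d m u) * M, fun x => ?_⟩
  rw [← integral_sub_left_eq_self (cov d m) volume x, ← integral_mul_const, smear,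
    ← Real.norm_eq_abs]
  refine norm_integral_le_of_norm_le (((integrable_cov hm).comp_sub_left x).mul_const M) ?_
  filter_upwards [ae_comp_sub_left (ae_cov_pos hm) x] with y hy
  rw [norm_mul, Real.norm_eq_abs, abs_of_pos hy]
  exact mul_le_mul_of_nonneg_left (hM y) hy.le

lemma ae_tendsto_ratio (hd : 2 ≤ d) (hm : 0 < m) :
    ∀ᵐ x : Space d, Tendsto (fun Λ => covCutoff d m Λ x / covCutoff d m Λ 0) atTop (𝓝 0) := by
  filter_upwards [ae_tendsto_cov (d := d) hm] with x hx
  exact hx.div_atTop (tendsto_covCutoff_zero hd hm)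

end HeatKernel

/-! ### Exponential moments of concentrating bounded variables. -/

section Concentration

lemma abs_exp_sub_one_sub_id_le_sq (s : ℝ) :
    |Real.exp s - 1 - s| ≤ s ^ 2 * Real.exp |s| := by
  have h := Complex.norm_exp_sub_sum_le_norm_mul_exp (s : ℂ) 2
  simp only [Finset.sum_range_succ, Finset.sum_range_zero, zero_add, pow_zero, Nat.factorial_zero,
    pow_one, Nat.factorial_one, Nat.cast_one, div_one] at h
  rw [← Complex.ofReal_exp, ← Complex.ofReal_one, ← Complex.ofReal_add, ← Complex.ofReal_sub,
    Complex.norm_real, Complex.norm_real, Real.norm_eq_abs, Real.norm_eq_abs, sq_abs] at h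
  rwa [sub_sub]

/-- Uniformly bounded random variables whose first and second moments converge to those of a
constant have exponential moments converging to those of the constant. -/
lemma tendsto_integral_exp_of_moments {Ω ι : Type*} [MeasurableSpace Ω] {l : Filter ι}
    {P : ι → Measure Ω} {X : ι → Ω → ℝ} {R c : ℝ} (lam : ℝ)
    (hP : ∀ᶠ i in l, IsProbabilityMeasure (P i)) (hX : ∀ i, Measurable (X i))
    (hR : ∀ i ω, |X i ω| ≤ R) (h1 : Tendsto (fun i => ∫ ω, X i ω ∂(P i)) l (𝓝 c))
    (h2 : Tendsto (fun i => ∫ ω, (X i ω) ^ 2 ∂(P i)) l (𝓝 (c ^ 2))) :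
    Tendsto (fun i => ∫ ω, Real.exp (-lam * X i ω) ∂(P i)) l (𝓝 (Real.exp (-lam * c))) := by
  set S : ℝ := |lam| * (R + |c|) with hS
  have hvar : Tendsto (fun i => (∫ ω, (X i ω) ^ 2 ∂(P i)) - 2 * c * (∫ ω, X i ω ∂(P i)) + c ^ 2) l
      (𝓝 0) := by
    have := (h2.sub (h1.const_mul (2 * c))).add_const (c ^ 2)
    convert this using 2
    ring
  have hmean : Tendsto (fun i => (∫ ω, X i ω ∂(P i)) - c) l (𝓝 0) := by
    simpa using h1.sub_const c
  have hb : Tendsto (fun i => Real.exp (-lam * c) *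
      (|lam| * |(∫ ω, X i ω ∂(P i)) - c| + lam ^ 2 * Real.exp S *
        ((∫ ω, (X i ω) ^ 2 ∂(P i)) - 2 * c * (∫ ω, X i ω ∂(P i)) + c ^ 2))) l (𝓝 0) := by
    have := ((hmean.abs.const_mul |lam|).add
      (hvar.const_mul (lam ^ 2 * Real.exp S))).const_mul (Real.exp (-lam * c))
    simpa using this
  rw [tendsto_iff_norm_sub_tendsto_zero]
  refine squeeze_zero' (Eventually.of_forall fun i => norm_nonneg _) ?_ hb
  filter_upwards [hP] with i hi
  have iX : Integrable (X i) (P i) :=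
    Integrable.of_bound (hX i).aestronglyMeasurable R (Eventually.of_forall (hR i))
  have iX2 : Integrable (fun ω => (X i ω) ^ 2) (P i) :=
    Integrable.of_bound ((hX i).pow_const 2).aestronglyMeasurable (R ^ 2)
      (Eventually.of_forall fun ω => by
        rw [norm_pow]
        exact pow_le_pow_left₀ (norm_nonneg _) (hR i ω) 2)
  set s : Ω → ℝ := fun ω => -lam * (X i ω - c) with hs
  have is : Integrable s (P i) := (iX.sub (integrable_const c)).const_mul _
  have is2 : Integrable (fun ω => (s ω) ^ 2) (P i) := by
    have : (fun ω => (s ω) ^ 2)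
        = fun ω => lam ^ 2 * ((X i ω) ^ 2 - 2 * c * X i ω + c ^ 2) := by
      funext ω
      simp only [hs]
      ring
    rw [this]
    exact ((iX2.sub (iX.const_mul (2 * c))).add (integrable_const _)).const_mul _
  have hsS : ∀ ω, |s ω| ≤ S := fun ω => by
    rw [hs, hS, abs_mul, abs_neg]
    gcongr
    exact (abs_sub _ _).trans (by gcongr; exact hR i ω)
  have ie : Integrable (fun ω => Real.exp (s ω)) (P i) :=
    Integrable.of_bound (by fun_prop) (Real.exp S)
      (Eventually.of_forall fun ω => by
        rw [Real.norm_eq_abs, Real.abs_exp, Real.exp_le_exp]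
        exact (le_abs_self _).trans (hsS ω))
  have e1 : ∫ ω, Real.exp (-lam * X i ω) ∂(P i)
      = Real.exp (-lam * c) * ∫ ω, Real.exp (s ω) ∂(P i) := by
    rw [← integral_const_mul]
    congr 1 with ω
    rw [← Real.exp_add]
    congr 1
    simp only [hs]
    ring
  have e2 : ∫ ω, s ω ∂(P i) = -lam * ((∫ ω, X i ω ∂(P i)) - c) := by
    rw [hs, integral_const_mul, integral_sub iX (integrable_const c)]
    simp
  have e3 : ∫ ω, (s ω) ^ 2 ∂(P i) = lam ^ 2 *
      ((∫ ω, (X i ω) ^ 2 ∂(P i)) - 2 * c * (∫ ω, X i ω ∂(P i)) + c ^ 2) := by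
    have : (fun ω => (s ω) ^ 2)
        = fun ω => lam ^ 2 * ((X i ω) ^ 2 - 2 * c * X i ω + c ^ 2) := by
      funext ω
      simp only [hs]
      ring
    have i1 : Integrable (fun ω => (X i ω) ^ 2 - 2 * c * X i ω) (P i) :=
      iX2.sub (iX.const_mul (2 * c))
    rw [this, integral_const_mul, integral_add i1 (integrable_const _), integral_sub iX2
      (iX.const_mul (2 * c)), integral_const_mul]
    simp
  -- The Taylor remainder is controlled by the second moment about `c`, which tends to zero by the
  -- two moment hypotheses.
  have e4 : |(∫ ω, Real.exp (s ω) ∂(P i)) - 1 - ∫ ω, s ω ∂(P i)|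
      ≤ Real.exp S * ∫ ω, (s ω) ^ 2 ∂(P i) := by
    have h3 : (∫ ω, Real.exp (s ω) ∂(P i)) - 1 - ∫ ω, s ω ∂(P i)
        = ∫ ω, (Real.exp (s ω) - 1 - s ω) ∂(P i) := by
      have i1 : Integrable (fun ω => Real.exp (s ω) - 1) (P i) := ie.sub (integrable_const 1)
      rw [integral_sub i1 is, integral_sub ie (integrable_const 1)]
      simp
    rw [h3, ← integral_const_mul, ← Real.norm_eq_abs]
    refine norm_integral_le_of_norm_le (is2.const_mul _) (Eventually.of_forall fun ω => ?_)
    refine (abs_exp_sub_one_sub_id_le_sq _).trans ?_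
    rw [mul_comm]
    gcongr
    exact hsS ω
  rw [e1]
  have e5 : Real.exp (-lam * c) * (∫ ω, Real.exp (s ω) ∂(P i)) - Real.exp (-lam * c)
      = Real.exp (-lam * c) * ((∫ ω, Real.exp (s ω) ∂(P i)) - 1) := by ring
  rw [e5, norm_mul, Real.norm_eq_abs, Real.abs_exp]
  gcongr
  rw [Real.norm_eq_abs]
  calc |(∫ ω, Real.exp (s ω) ∂(P i)) - 1|
      ≤ |∫ ω, s ω ∂(P i)| + |(∫ ω, Real.exp (s ω) ∂(P i)) - 1 - ∫ ω, s ω ∂(P i)| := by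
        have := abs_add_le (∫ ω, s ω ∂(P i)) ((∫ ω, Real.exp (s ω) ∂(P i)) - 1 - ∫ ω, s ω ∂(P i))
        rwa [add_sub_cancel] at this
    _ ≤ _ := by
        rw [e3] at e4
        rw [e2] at e4 ⊢
        rw [abs_mul, abs_neg]
        linarith

end Concentration

/-! ### The volume of the box. -/

section Box

variable {d : ℕ} {L : ℝ}

lemma volume_box_lt_top : volume (box d L) < ⊤ := by
  have hsub : box d L ⊆ Metric.closedBall 0 √(∑ _i : Fin d, (L / 2) ^ 2) := by
    intro x hx
    rw [mem_closedBall_zero_iff, EuclideanSpace.norm_eq]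
    refine Real.sqrt_le_sqrt (Finset.sum_le_sum fun i _ => ?_)
    rw [Real.norm_eq_abs]
    exact pow_le_pow_left₀ (abs_nonneg _) (abs_le.2 (hx i)) 2
  exact (measure_mono hsub).trans_lt measure_closedBall_lt_top

instance isFiniteMeasure_box : IsFiniteMeasure (volume.restrict (box d L)) :=
  ⟨by simpa using volume_box_lt_top⟩

lemma volume_box_pos (hL : 0 < L) : 0 < volume (box d L) := by
  refine (Metric.measure_ball_pos volume (0 : Space d) (half_pos hL)).trans_le
    (measure_mono fun x hx => ?_)
  rw [mem_ball_zero_iff] at hx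
  exact fun i => abs_le.1 ((PiLp.norm_apply_le x i).trans hx.le)

end Box

/-! ### Measurability, bounds and moments of the interaction. -/

section Interaction

variable {d : ℕ} {L M : ℝ} {W : ℝ → ℝ}

lemma measurable_interaction_integrand (hW : Measurable W) :
    Measurable fun p : TField d × Space d => W (p.1.value p.2) :=
  hW.comp measurable_value

lemma measurable_interaction_integrand_mul (hW : Measurable W) :
    Measurable fun z : (Space d × Space d) × TField d =>
      W (z.2.value z.1.1) * W (z.2.value z.1.2) := by
  have h := measurable_interaction_integrand (d := d) hW
  have h1 : Measurable fun z : (Space d × Space d) × TField d => (z.2, z.1.1) := by fun_prop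
  have h2 : Measurable fun z : (Space d × Space d) × TField d => (z.2, z.1.2) := by fun_prop
  have h3 := h.comp h1
  have h4 := h.comp h2
  simp only [Function.comp_def] at h3 h4
  exact h3.mul h4

lemma measurable_interaction (hW : Measurable W) :
    Measurable (interaction L W : TField d → ℝ) :=
  ((measurable_interaction_integrand hW).stronglyMeasurable.integral_prod_right
    (ν := volume.restrict (box d L))).measurable

lemma abs_interaction_le (hM : ∀ w, |W w| ≤ M) (φ : TField d) :
    |interaction L W φ| ≤ M * volume.real (box d L) := by
  rw [interaction, ← Real.norm_eq_abs]
  exact norm_setIntegral_le_of_norm_le_const volume_box_lt_top fun _ _ => hM _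

lemma integrable_generating {ν : Measure (TField d)} {K : Space d → ℝ}
    (hν : IsCenteredGaussian ν K) (hW : Measurable W) (hM : ∀ w, |W w| ≤ M) (lam : ℝ)
    (J : 𝓢(Space d, ℝ)) :
    Integrable (fun φ : TField d => Real.exp (φ J) * Real.exp (-lam * interaction L W φ)) ν := by
  refine (hν.integrable_exp J).mul_bdd (c := Real.exp (|lam| * (M * volume.real (box d L))))
    (Real.measurable_exp.comp ((measurable_interaction hW).const_mul _)).aestronglyMeasurable
    (Eventually.of_forall fun φ => ?_)
  rw [Real.norm_eq_abs, Real.abs_exp, Real.exp_le_exp]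
  refine (le_abs_self _).trans ?_
  rw [abs_mul, abs_neg]
  gcongr
  exact abs_interaction_le hM φ

lemma integral_interaction {P : Measure (TField d)} [IsProbabilityMeasure P] (hW : Measurable W)
    (hM : ∀ w, |W w| ≤ M) :
    ∫ φ, interaction L W φ ∂P = ∫ x in box d L, ∫ φ : TField d, W (φ.value x) ∂P := by
  refine integral_integral_swap (f := fun (φ : TField d) x => W (φ.value x)) ?_
  exact Integrable.of_bound (measurable_interaction_integrand hW).aestronglyMeasurable M
    (Eventually.of_forall fun _ => hM _)

lemma integral_interaction_sq {P : Measure (TField d)} [IsProbabilityMeasure P] (hW : Measurable W)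
    (hM : ∀ w, |W w| ≤ M) :
    ∫ φ, (interaction L W φ) ^ 2 ∂P
      = ∫ x in box d L, ∫ y in box d L, ∫ φ : TField d, W (φ.value x) * W (φ.value y) ∂P := by
  have hM0 : 0 ≤ M := (abs_nonneg _).trans (hM 0)
  have e1 : ∀ φ : TField d, (interaction L W φ) ^ 2
      = ∫ x in box d L, W (φ.value x) * interaction L W φ := fun φ => by
    rw [integral_mul_const, sq]
    rfl
  have e2 : ∀ (φ : TField d) (x : Space d), W (φ.value x) * interaction L W φ
      = ∫ y in box d L, W (φ.value x) * W (φ.value y) := fun φ x => by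
    rw [integral_const_mul]
    rfl
  simp only [e1]
  rw [integral_integral_swap]
  · refine integral_congr_ae (Eventually.of_forall fun x => ?_)
    simp only [e2]
    refine integral_integral_swap (f := fun (φ : TField d) y => W (φ.value x) * W (φ.value y)) ?_
    refine Integrable.of_bound (Measurable.aestronglyMeasurable ?_) (M * M)
      (Eventually.of_forall fun p => ?_)
    · exact ((hW.comp (measurable_value_right x)).comp measurable_fst).mul
        (measurable_interaction_integrand hW)
    · simp only [Function.uncurry]
      rw [norm_mul]
      exact mul_le_mul (hM _) (hM _) (norm_nonneg _) hM0
  · refine Integrable.of_bound (Measurable.aestronglyMeasurable ?_)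
      (M * (M * volume.real (box d L))) (Eventually.of_forall fun p => ?_)
    · exact (measurable_interaction_integrand hW).mul
        ((measurable_interaction hW).comp measurable_fst)
    · simp only [Function.uncurry]
      rw [norm_mul]
      exact mul_le_mul (hM _) (abs_interaction_le hM _) (norm_nonneg _) hM0

end Interaction

/-! ### The limit of the connected functional for a general potential. -/

section Limit

variable {d : ℕ} {m : ℝ}

lemma smear_const_mul (c : ℝ) (K : Space d → ℝ) (J : 𝓢(Space d, ℝ)) (x : Space d) :
    smear (fun u => c * K u) J x = c * smear K J x := by
  simp only [smear, mul_assoc]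
  exact integral_const_mul _ _

/-- The extra factor `C_Λ(0)` in the covariance is what makes this work: division by `C_Λ(0)` gives
the point values unit variance, while their covariance with `φ(J)` is exactly `⟨δ_x, C_Λ J⟩`, with
no factor left. -/
lemma tilted_integral_value (hm : 0 < m) {Λ : ℝ} (hΛ : 0 < Λ) {ν : Measure (TField d)}
    (hν : IsCenteredGaussian ν fun x => covCutoff d m Λ 0 * covCutoff d m Λ x)
    (J : 𝓢(Space d, ℝ)) (x y : Space d)
    (hr : (covCutoff d m Λ (x - y) / covCutoff d m Λ 0) ^ 2 < 1) {F : ℝ × ℝ → ℝ}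
    (hF : Measurable F) :
    ∫ φ : TField d, F (φ.value x / covCutoff d m Λ 0, φ.value y / covCutoff d m Λ 0)
        ∂(ν.tilted fun φ => φ J)
      = ∫ p : ℝ × ℝ, F (p.1 + smear (covCutoff d m Λ) J x,
          covCutoff d m Λ (x - y) / covCutoff d m Λ 0 * p.1 + smear (covCutoff d m Λ) J y
            + √(1 - (covCutoff d m Λ (x - y) / covCutoff d m Λ 0) ^ 2) * p.2)
          ∂((gaussianReal 0 1).prod (gaussianReal 0 1)) := by
  have hprob := hν.prob
  have hC := (covCutoff_pos (d := d) hm hΛ 0).ne'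
  set C := covCutoff d m Λ 0 with hCdef
  set K : Space d → ℝ := fun x => C * covCutoff d m Λ x with hK
  have hreg : IsRegularKernel K := (isRegularKernel_covCutoff hm hΛ).const_mul C
  refine tilted_integral_pair (P := ν) (X := fun φ : TField d => φ J)
    (Y := fun φ : TField d => φ.value x / C) (Z := fun φ : TField d => φ.value y / C)
    (A := covForm K J J) (measurable_eval J) ((measurable_value_right x).div_const C)
    ((measurable_value_right y).div_const C) hr (fun u s t => ?_) hF
  have h := hν.charFun_value hreg J x y u (s / C) (t / C)
  have e : ∀ φ : TField d, u * φ J + s / C * φ.value x + t / C * φ.value y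
      = u * φ J + s * (φ.value x / C) + t * (φ.value y / C) := fun φ => by ring
  simp only [e] at h
  rw [h]
  congr 3
  rw [hK, smear_const_mul, smear_const_mul]
  simp only [← hCdef]
  field_simp

variable {M : ℝ} {W : ℝ → ℝ → ℝ} {U : ℝ → ℝ} {ν : ℝ → Measure (TField d)}

lemma tendsto_connectedGenerating (hd : 2 ≤ d) (hm : 0 < m) (lam L : ℝ)
    (hν : ∀ Λ : ℝ, Real.exp 1 ≤ Λ →
      IsCenteredGaussian (ν Λ) (fun x => covCutoff d m Λ 0 * covCutoff d m Λ x))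
    (hW : ∀ Λ, Measurable (W Λ)) (hM : ∀ Λ w, |W Λ w| ≤ M)
    (hU : ∀ᵐ w, Tendsto (fun Λ => W Λ (covCutoff d m Λ 0 * w)) atTop (𝓝 (U w)))
    (J : 𝓢(Space d, ℝ)) :
    Tendsto (fun Λ => connectedGenerating (ν Λ) lam L (W Λ) J) atTop
      (𝓝 (-lam * ∫ x in box d L, gaussMean U (smear (cov d m) J x))) := by
  have hM0 : 0 ≤ M := (abs_nonneg _).trans (hM 0 0)
  have hgood : ∀ᶠ Λ : ℝ in atTop, 0 < Λ ∧ Real.exp 1 ≤ Λ :=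
    (eventually_gt_atTop 0).and (eventually_ge_atTop _)
  set P : ℝ → Measure (TField d) := fun Λ => (ν Λ).tilted fun φ => φ J with hPdef
  have hP : ∀ᶠ Λ in atTop, IsProbabilityMeasure (P Λ) := by
    filter_upwards [hgood] with Λ hΛ
    have := (hν Λ hΛ.2).prob
    exact isProbabilityMeasure_tilted ((hν Λ hΛ.2).integrable_exp J)
  set W' : ℝ → ℝ → ℝ := fun Λ w => W Λ (covCutoff d m Λ 0 * w) with hW'
  have hW'm : ∀ Λ, Measurable (W' Λ) := fun Λ => (hW Λ).comp (by fun_prop)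
  have hW'M : ∀ Λ w, |W' Λ w| ≤ M := fun Λ w => hM _ _
  have hval : ∀ Λ, 0 < Λ → ∀ (φ : TField d) x,
      W Λ (φ.value x) = W' Λ (φ.value x / covCutoff d m Λ 0) := by
    intro Λ hΛ φ x
    simp only [hW']
    rw [mul_div_cancel₀ _ (covCutoff_pos hm hΛ 0).ne']
  have hratio : ∀ x : Space d, ∀ᵐ y : Space d,
      Tendsto (fun Λ => covCutoff d m Λ (x - y) / covCutoff d m Λ 0) atTop (𝓝 0) := fun x =>
    ae_comp_sub_left (ae_tendsto_ratio hd hm) x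
  have hlt : ∀ {x y : Space d},
      Tendsto (fun Λ => covCutoff d m Λ (x - y) / covCutoff d m Λ 0) atTop (𝓝 0) →
      ∀ᶠ Λ in atTop, (covCutoff d m Λ (x - y) / covCutoff d m Λ 0) ^ 2 < 1 := by
    intro x y h
    exact (h.pow 2).eventually (gt_mem_nhds (by norm_num))
  have hone : ∀ x : Space d, Tendsto (fun Λ => ∫ φ : TField d, W Λ (φ.value x) ∂(P Λ)) atTop
      (𝓝 (gaussMean U (smear (cov d m) J x))) := by
    intro x
    -- The auxiliary second point only serves to reuse the two-point formula, which needs a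
    -- correlation of absolute value below one.
    obtain ⟨y, hy⟩ := (hratio x).exists
    refine (tendsto_integral_prod_fst hW'm hW'M hU (tendsto_smear hm J x)).congr' ?_
    filter_upwards [hgood, hlt hy] with Λ hΛ hr
    simp only [hval Λ hΛ.1]
    exact (tilted_integral_value hm hΛ.1 (hν Λ hΛ.2) J x y hr
      (F := fun p => W' Λ p.1) ((hW'm Λ).comp measurable_fst)).symm
  -- Only almost every `y` is available (on the diagonal the correlation is one), which suffices
  -- under the double integral.
  have htwo : ∀ x : Space d, ∀ᵐ y : Space d,
      Tendsto (fun Λ => ∫ φ : TField d, W Λ (φ.value x) * W Λ (φ.value y) ∂(P Λ)) atTop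
      (𝓝 (gaussMean U (smear (cov d m) J x) * gaussMean U (smear (cov d m) J y))) := by
    intro x
    filter_upwards [hratio x] with y hy
    refine (tendsto_integral_prod_mul hW'm hW'M hU (tendsto_smear hm J x) (tendsto_smear hm J y)
      hy).congr' ?_
    filter_upwards [hgood, hlt hy] with Λ hΛ hr
    simp only [hval Λ hΛ.1]
    exact (tilted_integral_value hm hΛ.1 (hν Λ hΛ.2) J x y hr
      (F := fun p => W' Λ p.1 * W' Λ p.2)
      (((hW'm Λ).comp measurable_fst).mul ((hW'm Λ).comp measurable_snd))).symm
  set c : ℝ := ∫ x in box d L, gaussMean U (smear (cov d m) J x) with hc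
  have hmeas1 : ∀ Λ, Measurable fun p : TField d × Space d => W Λ (p.1.value p.2) := fun Λ =>
    measurable_interaction_integrand (hW Λ)
  have hE1 : Tendsto (fun Λ => ∫ φ, interaction L (W Λ) φ ∂(P Λ)) atTop (𝓝 c) := by
    have h1 : Tendsto (fun Λ => ∫ x in box d L, ∫ φ : TField d, W Λ (φ.value x) ∂(P Λ)) atTop
        (𝓝 c) := by
      refine tendsto_integral_filter_of_dominated_convergence (fun _ => M) ?_ ?_
        (integrable_const M) (Eventually.of_forall hone)
      · filter_upwards [hP] with Λ hPΛ
        exact ((hmeas1 Λ).stronglyMeasurable.integral_prod_left').aestronglyMeasurable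
      · filter_upwards [hP] with Λ hPΛ
        refine Eventually.of_forall fun x => ?_
        simpa using norm_integral_le_of_norm_le_const (μ := P Λ)
          (f := fun φ : TField d => W Λ (φ.value x)) (Eventually.of_forall fun _ => hM _ _)
    refine h1.congr' ?_
    filter_upwards [hP] with Λ hPΛ
    exact (integral_interaction (hW Λ) (hM Λ)).symm
  have hpair : ∀ Λ (x y : Space d) [IsProbabilityMeasure (P Λ)],
      ‖∫ φ : TField d, W Λ (φ.value x) * W Λ (φ.value y) ∂(P Λ)‖ ≤ M * M := by
    intro Λ x y _
    simpa using norm_integral_le_of_norm_le_const (μ := P Λ) (C := M * M)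
      (f := fun φ : TField d => W Λ (φ.value x) * W Λ (φ.value y))
      (Eventually.of_forall fun _ => by
        rw [norm_mul]
        exact mul_le_mul (hM _ _) (hM _ _) (norm_nonneg _) hM0)
  have hmeas2 : ∀ Λ [IsProbabilityMeasure (P Λ)], StronglyMeasurable fun q : Space d × Space d =>
      ∫ φ : TField d, W Λ (φ.value q.1) * W Λ (φ.value q.2) ∂(P Λ) := by
    intro Λ _
    exact (measurable_interaction_integrand_mul (hW Λ)).stronglyMeasurable.integral_prod_right
  have hE2 : Tendsto (fun Λ => ∫ φ, (interaction L (W Λ) φ) ^ 2 ∂(P Λ)) atTop (𝓝 (c ^ 2)) := by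
    have hin : ∀ x : Space d, Tendsto (fun Λ => ∫ y in box d L,
        ∫ φ : TField d, W Λ (φ.value x) * W Λ (φ.value y) ∂(P Λ)) atTop
        (𝓝 (gaussMean U (smear (cov d m) J x) * c)) := by
      intro x
      rw [hc, ← integral_const_mul]
      refine tendsto_integral_filter_of_dominated_convergence (fun _ => M * M) ?_ ?_
        (integrable_const _) (ae_restrict_of_ae (htwo x))
      · filter_upwards [hP] with Λ hPΛ
        exact ((hmeas2 Λ).comp_measurable measurable_prodMk_left).aestronglyMeasurable
      · filter_upwards [hP] with Λ hPΛ
        exact Eventually.of_forall fun y => hpair Λ x y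
    have h2 : Tendsto (fun Λ => ∫ x in box d L, ∫ y in box d L,
        ∫ φ : TField d, W Λ (φ.value x) * W Λ (φ.value y) ∂(P Λ)) atTop (𝓝 (c ^ 2)) := by
      have e : c ^ 2 = ∫ x in box d L, gaussMean U (smear (cov d m) J x) * c := by
        rw [integral_mul_const, sq]
      rw [e]
      refine tendsto_integral_filter_of_dominated_convergence
        (fun _ => M * M * volume.real (box d L)) ?_ ?_
        (integrable_const _) (Eventually.of_forall hin)
      · filter_upwards [hP] with Λ hPΛ
        exact (hmeas2 Λ).integral_prod_right'.aestronglyMeasurable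
      · filter_upwards [hP] with Λ hPΛ
        exact Eventually.of_forall fun x =>
          norm_setIntegral_le_of_norm_le_const volume_box_lt_top fun y _ => hpair Λ x y
    refine h2.congr' ?_
    filter_upwards [hP] with Λ hPΛ
    exact (integral_interaction_sq (hW Λ) (hM Λ)).symm
  have hexp := tendsto_integral_exp_of_moments lam hP (fun Λ => measurable_interaction (hW Λ))
    (fun Λ φ => abs_interaction_le (hM Λ) φ) hE1 hE2
  have hlog := (Real.continuousAt_log (Real.exp_pos (-lam * c)).ne').tendsto.comp hexp
  rw [Real.log_exp] at hlog
  refine hlog.congr' ?_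
  filter_upwards [hgood] with Λ hΛ
  simp only [Function.comp_apply, connectedGenerating, generating, freeGenerating, hPdef]
  -- The quotient of generating functionals is the tilted expectation of `e^{-λ·interaction}`.
  rw [integral_exp_tilted]
  congr 3
  funext φ
  rw [Pi.add_apply, Real.exp_add]

end Limit

/-! ### Smoothness and third derivative of the error function. -/

section ErrorFunction

open scoped ContDiff

lemma measurable_sign_real : Measurable fun w : ℝ => (SignType.sign w : ℝ) := by
  have e : (fun w : ℝ => (SignType.sign w : ℝ))
      = fun w => if 0 < w then 1 else if w < 0 then -1 else 0 := by
    funext w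
    rcases lt_trichotomy w 0 with h | h | h
    · simp [h, h.not_gt]
    · simp [h]
    · simp [h]
  rw [e]
  exact Measurable.ite measurableSet_Ioi measurable_const
    (Measurable.ite measurableSet_Iio measurable_const measurable_const)

lemma abs_sign_real_le (w : ℝ) : |(SignType.sign w : ℝ)| ≤ 1 := by
  rcases lt_trichotomy w 0 with h | h | h <;> simp [h]

/-- The unnormalized error function `s ↦ ∫ sgn(w) e^{-(w - s)² / 2} dw`. -/
noncomputable def erfInt (s : ℝ) : ℝ :=
  ∫ w : ℝ, (SignType.sign w : ℝ) * Real.exp (-(1 / 2) * (w - s) ^ 2)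

/-- After translation the negative part reflects to the tail beyond `s`, which cancels against the
positive part. The discontinuous sign disappears and the fundamental theorem of calculus applies. -/
lemma erfInt_eq (s : ℝ) : erfInt s = ∫ v in (-s)..s, Real.exp (-(1 / 2) * v ^ 2) := by
  have hint : Integrable fun v : ℝ => Real.exp (-(1 / 2) * v ^ 2) :=
    integrable_exp_neg_mul_sq (by norm_num)
  have hsign : Integrable fun v : ℝ => (SignType.sign (v + s) : ℝ) * Real.exp (-(1 / 2) * v ^ 2)
      := by
    exact hint.bdd_mul (c := 1)
      (measurable_sign_real.comp (measurable_id.add_const s)).aestronglyMeasurable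
      (Eventually.of_forall fun v => abs_sign_real_le _)
  have e1 : erfInt s = ∫ v : ℝ, (SignType.sign (v + s) : ℝ) * Real.exp (-(1 / 2) * v ^ 2) := by
    rw [erfInt, ← integral_add_right_eq_self _ s]
    simp
  rw [e1, ← intervalIntegral.integral_Iic_add_Ioi (b := -s) hsign.integrableOn hsign.integrableOn]
  have e2 : ∫ v in Ioi (-s), (SignType.sign (v + s) : ℝ) * Real.exp (-(1 / 2) * v ^ 2)
      = ∫ v in Ioi (-s), Real.exp (-(1 / 2) * v ^ 2) :=
    setIntegral_congr_fun measurableSet_Ioi fun v hv => by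
      have : 0 < v + s := by linarith [mem_Ioi.1 hv]
      simp [this]
  have e3 : ∫ v in Iic (-s), (SignType.sign (v + s) : ℝ) * Real.exp (-(1 / 2) * v ^ 2)
      = -∫ v in Ioi s, Real.exp (-(1 / 2) * v ^ 2) := by
    have h4 := integral_comp_neg_Iic (-s) fun v => Real.exp (-(1 / 2) * v ^ 2)
    simp only [neg_sq, neg_neg] at h4
    rw [← h4, integral_Iic_eq_integral_Iio, integral_Iic_eq_integral_Iio, ← integral_neg]
    refine setIntegral_congr_fun measurableSet_Iio fun v hv => ?_
    have : v + s < 0 := by linarith [mem_Iio.1 hv]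
    simp [this]
  rw [e2, e3, neg_add_eq_sub,
    intervalIntegral.integral_Ioi_sub_Ioi' hint.integrableOn hint.integrableOn]

lemma hasDerivAt_erfInt (s : ℝ) : HasDerivAt erfInt (2 * Real.exp (-(1 / 2) * s ^ 2)) s := by
  have hc : Continuous fun v : ℝ => Real.exp (-(1 / 2) * v ^ 2) := by fun_prop
  have h1 : ∀ a, HasDerivAt (fun t => ∫ v in (0 : ℝ)..t, Real.exp (-(1 / 2) * v ^ 2))
      (Real.exp (-(1 / 2) * a ^ 2)) a := fun a =>
    intervalIntegral.integral_hasDerivAt_right (hc.intervalIntegrable _ _)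
      (hc.stronglyMeasurableAtFilter _ _) hc.continuousAt
  have h2 := (h1 s).sub ((h1 (-s)).comp s (hasDerivAt_neg s))
  have e : erfInt = (fun t => ∫ v in (0 : ℝ)..t, Real.exp (-(1 / 2) * v ^ 2))
      - (fun t => ∫ v in (0 : ℝ)..t, Real.exp (-(1 / 2) * v ^ 2)) ∘ Neg.neg := by
    funext t
    rw [erfInt_eq, Pi.sub_apply, Function.comp_apply,
      intervalIntegral.integral_interval_sub_left (hc.intervalIntegrable _ _)
        (hc.intervalIntegrable _ _)]
  rw [e]
  refine h2.congr_deriv ?_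
  rw [neg_sq]
  ring

lemma deriv_erfInt : deriv erfInt = fun s => 2 * Real.exp (-(1 / 2) * s ^ 2) :=
  funext fun s => (hasDerivAt_erfInt s).deriv

lemma contDiff_erfInt : ContDiff ℝ ∞ erfInt := by
  rw [contDiff_infty_iff_deriv, deriv_erfInt]
  exact ⟨fun s => (hasDerivAt_erfInt s).differentiableAt, by fun_prop⟩

lemma iteratedDeriv_three_erfInt : iteratedDeriv 3 erfInt 0 = -2 := by
  have h1 : ∀ s : ℝ, HasDerivAt (fun s => 2 * Real.exp (-(1 / 2) * s ^ 2))
      (-2 * s * Real.exp (-(1 / 2) * s ^ 2)) s := by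
    intro s
    have := (((hasDerivAt_pow 2 s).const_mul (-(1 / 2) : ℝ)).exp).const_mul 2
    refine this.congr_deriv ?_
    push_cast
    ring
  have h2 : HasDerivAt (fun s : ℝ => -2 * s * Real.exp (-(1 / 2) * s ^ 2)) (-2) 0 := by
    have := ((hasDerivAt_id (0 : ℝ)).const_mul (-2 : ℝ)).mul
      (((hasDerivAt_pow 2 (0 : ℝ)).const_mul (-(1 / 2) : ℝ)).exp)
    refine this.congr_deriv ?_
    simp
  rw [iteratedDeriv_succ', deriv_erfInt, iteratedDeriv_succ',
    funext fun s => (h1 s).deriv, iteratedDeriv_one]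
  exact h2.deriv

end ErrorFunction

/-! ### Higher derivatives under the integral sign. -/

section ParametricIntegral

open scoped ContDiff

variable {α : Type*} [MeasurableSpace α] {μ : Measure α} [IsFiniteMeasure μ] {g : α → ℝ} {B : ℝ}

lemma hasDerivAt_integral_dilate (hg : Measurable g) (hB : ∀ x, |g x| ≤ B) {φ : ℝ → ℝ}
    (hφ : ContDiff ℝ ∞ φ) {k : α → ℝ} (hk : Measurable k) {C : ℝ} (hC : ∀ x, |k x| ≤ C) (t : ℝ) :
    HasDerivAt (fun t => ∫ x, k x * φ (t * g x) ∂μ)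
      (∫ x, k x * g x * deriv φ (t * g x) ∂μ) t := by
  have hφc := hφ.continuous
  have hφ' : Continuous (deriv φ) := hφ.continuous_deriv (by exact_mod_cast le_top)
  have hbdd : ∀ {ψ : ℝ → ℝ}, Continuous ψ → ∃ D, 0 ≤ D ∧
      ∀ s ∈ Metric.ball t 1, ∀ x, |ψ (s * g x)| ≤ D := by
    intro ψ hψ
    obtain ⟨D, hD⟩ := (isCompact_Icc (a := -((|t| + 1) * B)) (b := (|t| + 1) *
        B)).exists_bound_of_continuousOn
      hψ.continuousOn
    refine ⟨max D 0, le_max_right _ _, fun s hs x => (hD _ ?_).trans (le_max_left _ _)⟩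
    rw [mem_Icc, ← abs_le, abs_mul]
    have h1 : |s| ≤ |t| + 1 := by
      have h2 : |s - t| < 1 := by simpa [Real.dist_eq] using hs
      have := abs_sub_abs_le_abs_sub s t
      linarith
    exact mul_le_mul h1 (hB x) (abs_nonneg _) (by positivity)
  obtain ⟨D, hD0, hD⟩ := hbdd hφ'
  obtain ⟨D', hD'0, hD'⟩ := hbdd hφc
  have key := hasDerivAt_integral_of_dominated_loc_of_deriv_le (μ := μ) (𝕜 := ℝ)
    (F := fun t x => k x * φ (t * g x)) (F' := fun t x => k x * g x * deriv φ (t * g x))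
    (x₀ := t) (s := Metric.ball t 1) (bound := fun _ => C * B * D) (Metric.ball_mem_nhds t one_pos)
    (Eventually.of_forall fun s =>
      (hk.mul (hφc.measurable.comp (hg.const_mul s))).aestronglyMeasurable)
    (Integrable.of_bound (hk.mul (hφc.measurable.comp (hg.const_mul t))).aestronglyMeasurable
      (C * D') (Eventually.of_forall fun x => by
        rw [norm_mul]
        exact mul_le_mul (hC x) (hD' t (Metric.mem_ball_self one_pos) x) (norm_nonneg _)
          ((abs_nonneg _).trans (hC x))))
    ((hk.mul hg).mul (hφ'.measurable.comp (hg.const_mul t))).aestronglyMeasurable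
    (Eventually.of_forall fun x s hs => by
      have hC0 := (abs_nonneg _).trans (hC x)
      have hB0 := (abs_nonneg _).trans (hB x)
      rw [norm_mul, norm_mul]
      exact mul_le_mul (mul_le_mul (hC x) (hB x) (norm_nonneg _) hC0) (hD s hs x) (norm_nonneg _)
        (by positivity))
    (integrable_const _)
    (Eventually.of_forall fun x s _ => by
      have h1 : HasDerivAt φ (deriv φ (s * g x)) (s * g x) :=
        ((hφ.differentiable (by simp)) _).hasDerivAt
      have h2 := (h1.comp s ((hasDerivAt_id s).mul_const (g x))).const_mul (k x)
      refine h2.congr_deriv ?_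
      ring)
  exact key.2

/-- Each derivative brings down a factor `g`. The bounded weight `k` absorbs it, which closes the
induction; hence the quantification over `φ` and `k` inside. -/
lemma contDiff_integral_dilate (hg : Measurable g) (hB : ∀ x, |g x| ≤ B) (n : ℕ) :
    ∀ {φ : ℝ → ℝ}, ContDiff ℝ ∞ φ → ∀ {k : α → ℝ}, Measurable k → ∀ {C : ℝ}, (∀ x, |k x| ≤ C) →
    ContDiff ℝ n (fun t => ∫ x, k x * φ (t * g x) ∂μ) ∧
      ∀ t, iteratedDeriv n (fun t => ∫ x, k x * φ (t * g x) ∂μ) t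
        = ∫ x, k x * g x ^ n * iteratedDeriv n φ (t * g x) ∂μ := by
  induction n with
  | zero =>
    intro φ hφ k hk C hC
    refine ⟨contDiff_zero.2 (continuous_iff_continuousAt.2 fun t =>
      (hasDerivAt_integral_dilate hg hB hφ hk hC t).continuousAt), fun t => ?_⟩
    simp
  | succ n ih =>
    intro φ hφ k hk C hC
    have hd := fun t => hasDerivAt_integral_dilate (μ := μ) hg hB hφ hk hC t
    have hderiv : deriv (fun t => ∫ x, k x * φ (t * g x) ∂μ)
        = fun t => ∫ x, k x * g x * deriv φ (t * g x) ∂μ := funext fun t => (hd t).deriv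
    have hφ' : ContDiff ℝ ∞ (deriv φ) := (contDiff_infty_iff_deriv.1 hφ).2
    obtain ⟨h1, h2⟩ := ih hφ' (hk.mul hg) (C := C * B) fun x => by
      rw [Pi.mul_apply, abs_mul]
      exact mul_le_mul (hC x) (hB x) (abs_nonneg _) ((abs_nonneg _).trans (hC x))
    simp only [Pi.mul_apply] at h1 h2
    refine ⟨?_, fun t => ?_⟩
    · push_cast
      rw [contDiff_succ_iff_deriv]
      refine ⟨fun t => (hd t).differentiableAt, by simp, ?_⟩
      rw [hderiv]
      exact h1
    · rw [iteratedDeriv_succ', hderiv, h2, iteratedDeriv_succ']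
      congr 1 with x
      ring

end ParametricIntegral

/-! ### The limit functionals and non-Gaussianity. -/

section Functionals

variable {d : ℕ} {m : ℝ}

/-- The step function with value `a` on the positive and `b` on the negative half line. -/
noncomputable def stepFun (a b w : ℝ) : ℝ := (a + b) / 2 + (a - b) / 2 * (SignType.sign w : ℝ)

lemma stepFun_of_pos {a b w : ℝ} (hw : 0 < w) : stepFun a b w = a := by
  simp [stepFun, hw]
  ring

lemma stepFun_of_neg {a b w : ℝ} (hw : w < 0) : stepFun a b w = b := by
  simp [stepFun, hw]
  ring

lemma gaussMean_stepFun (a b c : ℝ) :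
    gaussMean (stepFun a b) c
      = (a + b) / 2 + (a - b) / 2 * (1 / √(2 * Real.pi)) * erfInt c := by
  have hi : Integrable (fun w : ℝ => (SignType.sign w : ℝ)) (gaussianReal c 1) :=
    Integrable.of_bound measurable_sign_real.aestronglyMeasurable 1
      (Eventually.of_forall abs_sign_real_le)
  have h := gaussMean_eq (fun w => (SignType.sign w : ℝ)) c
  rw [gaussMean] at h ⊢
  simp only [stepFun]
  rw [integral_add (integrable_const _) (hi.const_mul _), integral_const_mul, h]
  simp [erfInt]
  ring

lemma erfFunctional_eq (lam L a b : ℝ) (J : 𝓢(Space d, ℝ)) :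
    erfFunctional d m lam L a b J
      = -lam * volume.real (box d L) * ((a + b) / 2)
        + ∫ x in box d L, (-lam * ((a - b) / 2) * (1 / √(2 * Real.pi)))
            * erfInt (smear (cov d m) J x) := by
  rw [integral_const_mul, erfFunctional]
  simp only [erfInt]
  ring

lemma erfFunctional_eq_integral_gaussMean (hm : 0 < m) (lam L a b : ℝ) (J : 𝓢(Space d, ℝ)) :
    erfFunctional d m lam L a b J
      = -lam * ∫ x in box d L, gaussMean (stepFun a b) (smear (cov d m) J x) := by
  have hi : Integrable (fun x => (a - b) / 2 * (1 / √(2 * Real.pi)) *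
      erfInt (smear (cov d m) J x)) (volume.restrict (box d L)) := by
    refine Integrable.of_bound (Measurable.aestronglyMeasurable ?_) (|(a - b) / 2| * 1)
      (Eventually.of_forall fun x => ?_)
    · exact (contDiff_erfInt.continuous.measurable.comp (measurable_smear_cov hm J)).const_mul _
    · rw [mul_assoc, norm_mul, erfInt, ← gaussMean_eq fun w => (SignType.sign w : ℝ)]
      exact mul_le_mul_of_nonneg_left (abs_gaussMean_le abs_sign_real_le _) (abs_nonneg _)
  simp only [gaussMean_stepFun]
  rw [integral_add (integrable_const _) hi, erfFunctional_eq, integral_const_mul,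
    integral_const_mul]
  simp only [integral_const, smul_eq_mul, measureReal_restrict_apply_univ]
  ring

lemma convFunctional_eq (lam L : ℝ) (V : ℝ → ℝ) (J : 𝓢(Space d, ℝ)) :
    convFunctional d m lam L V J = -lam * ∫ x in box d L, gaussMean V (smear (cov d m) J x) := by
  simp only [gaussMean_eq]
  rw [integral_const_mul, convFunctional]
  ring

/-- Since `C` is positive almost everywhere, a vanishing integral would force the bump to vanish
almost everywhere, against its total mass one. -/
lemma smear_cov_pos (hm : 0 < m) (x : Space d) : 0 < smear (cov d m) (bumpAt 0 0) x := by
  have hpos := ae_comp_sub_left (ae_cov_pos (d := d) hm) x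
  have hnn : 0 ≤ᵐ[volume] fun y => cov d m (x - y) * bumpAt (0 : Space d) 0 y :=
    hpos.mono fun y hy => mul_nonneg hy.le (bumpAt_nonneg _ _ _)
  refine (integral_nonneg_of_ae hnn).lt_of_ne' fun h => ?_
  obtain ⟨M, -, hM⟩ := schwartz_bounded (bumpAt (0 : Space d) 0)
  rw [integral_eq_zero_iff_of_nonneg_ae hnn (((integrable_cov hm).comp_sub_left x).mul_bdd (c := M)
    (bumpAt (0 : Space d) 0).continuous.aestronglyMeasurable (Eventually.of_forall hM))] at h
  have h0 : ∀ᵐ y : Space d, bumpAt (0 : Space d) 0 y = 0 := by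
    filter_upwards [h, hpos] with y h1 h2
    exact (mul_eq_zero.1 h1).resolve_left h2.ne'
  have := integral_bumpAt (0 : Space d) 0
  rw [integral_congr_ae h0] at this
  simp at this

/-- The third derivative at the origin of the functional along a line. -/
lemma schwinger_three_erfFunctional (hm : 0 < m) (lam L a b : ℝ) (f : 𝓢(Space d, ℝ)) :
    schwinger (erfFunctional d m lam L a b) 3 (fun _ => f)
      = 2 * (lam * ((a - b) / 2) * (1 / √(2 * Real.pi)))
        * ∫ x in box d L, smear (cov d m) f x ^ 3 := by
  obtain ⟨B, hB⟩ := smear_cov_bounded (d := d) hm f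
  set g := smear (cov d m) f with hg
  set c : ℝ := -lam * ((a - b) / 2) * (1 / √(2 * Real.pi)) with hc
  set A : ℝ := -lam * volume.real (box d L) * ((a + b) / 2) with hA
  obtain ⟨h1, h2⟩ := contDiff_integral_dilate (μ := volume.restrict (box d L))
    (measurable_smear_cov hm f) hB 3 contDiff_erfInt (k := fun _ => c) measurable_const
    (C := |c|) (fun _ => le_rfl)
  set G : ℝ → ℝ := fun t => A + ∫ x in box d L, c * erfInt (t * g x) with hG
  have hGc : ContDiff ℝ 3 G := contDiff_const.add h1
  -- With equal test functions the functional depends on `ε` only through its coordinate sum, so the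
  -- mixed derivative is the third derivative of `G`.
  set ℓ : (Fin 3 → ℝ) →L[ℝ] ℝ := ∑ i, ContinuousLinearMap.proj i with hℓ
  have hℓa : ∀ ε, ℓ ε = ∑ i, ε i := fun ε => by simp [hℓ]
  have e : (fun ε : Fin 3 → ℝ => erfFunctional d m lam L a b (∑ i, ε i • f)) = G ∘ ℓ := by
    funext ε
    rw [erfFunctional_eq, ← Finset.sum_smul, Function.comp_apply, hℓa]
    simp only [IsRegularKernel.smear_smul, hG, hg, hA, hc]
  rw [schwinger, e, ContinuousLinearMap.iteratedFDeriv_comp_right ℓ hGc 0 (i := 3) le_rfl]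
  have hs : (fun i : Fin 3 => ℓ (Pi.single i 1)) = fun _ => 1 := by
    funext i
    rw [hℓa]
    simp
  rw [ContinuousMultilinearMap.compContinuousLinearMap_apply, hs, map_zero,
    ← iteratedDeriv_eq_iteratedFDeriv, hG, iteratedDeriv_const_add (by norm_num), h2 0]
  simp only [zero_mul, iteratedDeriv_three_erfInt]
  rw [integral_mul_const, integral_const_mul, hc]
  ring

/-- Equal limits leave a functional constant in `J`. Otherwise three copies of one positive bump
give a multiple of the integral of a positive cube. -/
lemma isNonGaussian_erfFunctional_iff (hm : 0 < m) {lam L : ℝ} (hL : 0 < L) (hlam : lam ≠ 0)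
    (a b : ℝ) : IsNonGaussian (erfFunctional d m lam L a b) ↔ a ≠ b := by
  constructor
  · rintro ⟨n, hn, f, hf⟩ rfl
    refine hf ?_
    have e : (fun ε : Fin n → ℝ => erfFunctional d m lam L a a (∑ i, ε i • f i))
        = fun _ => -lam * volume.real (box d L) * ((a + a) / 2) := by
      funext ε
      simp [erfFunctional]
    rw [schwinger, e, iteratedFDeriv_const_of_ne (by omega)]
    rfl
  · intro hab
    refine ⟨3, le_rfl, fun _ => bumpAt 0 0, ?_⟩
    rw [schwinger_three_erfFunctional hm]
    obtain ⟨B, hB⟩ := smear_cov_bounded (d := d) hm (bumpAt 0 0)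
    have hi : Integrable (fun x => smear (cov d m) (bumpAt 0 0) x ^ 3)
        (volume.restrict (box d L)) :=
      Integrable.of_bound ((measurable_smear_cov hm _).pow_const 3).aestronglyMeasurable (B ^ 3)
        (Eventually.of_forall fun x => by
          rw [norm_pow]
          exact pow_le_pow_left₀ (norm_nonneg _) (hB x) 3)
    have hpos : 0 < ∫ x in box d L, smear (cov d m) (bumpAt 0 0) x ^ 3 := by
      rw [integral_pos_iff_support_of_nonneg (fun x => pow_nonneg (smear_cov_pos hm x).le 3) hi]
      have : (Function.support fun x : Space d => smear (cov d m) (bumpAt 0 0) x ^ 3) = univ :=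
        eq_univ_of_forall fun x => (pow_pos (smear_cov_pos hm x) 3).ne'
      rw [this, Measure.restrict_apply_univ]
      exact volume_box_pos hL
    have hsq : 0 < √(2 * Real.pi) := Real.sqrt_pos.2 (by positivity)
    have hab' : (a - b) / 2 ≠ 0 := div_ne_zero (sub_ne_zero.2 hab) two_ne_zero
    exact mul_ne_zero (mul_ne_zero two_ne_zero (mul_ne_zero (mul_ne_zero hlam hab')
      (one_div_ne_zero hsq.ne'))) hpos.ne'

end Functionals

/-! ### Pointwise limits of the rescaled potential. -/

section Rescaling

variable {ι : Type*} {l : Filter ι} {V : ℝ → ℝ} {a b κ : ℝ} {C : ι → ℝ}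

lemma rpow_mul_mul {c κ w : ℝ} (hc : 0 < c) : c ^ κ * (c * w) = c ^ (κ + 1) * w := by
  rw [Real.rpow_add_one hc.ne']
  ring

/-- A rescaling which tends to zero turns a potential into its local step function at the
origin. -/
lemma tendsto_rescale_zero (hκ : κ < -1) (hC : Tendsto C l atTop)
    (ha : Tendsto V (𝓝[>] 0) (𝓝 a)) (hb : Tendsto V (𝓝[<] 0) (𝓝 b)) {w : ℝ} (hw : w ≠ 0) :
    Tendsto (fun i => V (C i ^ κ * (C i * w))) l (𝓝 (stepFun a b w)) := by
  have h0 : Tendsto (fun i => C i ^ (κ + 1)) l (𝓝 0) := by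
    have := (tendsto_rpow_neg_atTop (y := -(κ + 1)) (by linarith)).comp hC
    simpa [Function.comp_def] using this
  have h1 : Tendsto (fun i => C i ^ κ * (C i * w)) l (𝓝 0) := by
    have : Tendsto (fun i => C i ^ (κ + 1) * w) l (𝓝 0) := by simpa using h0.mul_const w
    refine this.congr' ?_
    filter_upwards [hC.eventually_gt_atTop 0] with i hi
    exact (rpow_mul_mul hi).symm
  rcases hw.lt_or_gt with hw | hw
  · rw [stepFun_of_neg hw]
    -- The rescaling factor is positive, so the argument approaches zero from the side of `w`.
    refine hb.comp (tendsto_nhdsWithin_iff.2 ⟨h1, ?_⟩)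
    filter_upwards [hC.eventually_gt_atTop 0] with i hi
    exact mul_neg_of_pos_of_neg (Real.rpow_pos_of_pos hi κ) (mul_neg_of_pos_of_neg hi hw)
  · rw [stepFun_of_pos hw]
    refine ha.comp (tendsto_nhdsWithin_iff.2 ⟨h1, ?_⟩)
    filter_upwards [hC.eventually_gt_atTop 0] with i hi
    exact mul_pos (Real.rpow_pos_of_pos hi κ) (mul_pos hi hw)

/-- A rescaling which tends to infinity turns a potential into the step function of its limits at
infinity. -/
lemma tendsto_rescale_infinity (hκ : -1 < κ) (hC : Tendsto C l atTop)
    (ha : Tendsto V atTop (𝓝 a)) (hb : Tendsto V atBot (𝓝 b)) {w : ℝ} (hw : w ≠ 0) :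
    Tendsto (fun i => V (C i ^ κ * (C i * w))) l (𝓝 (stepFun a b w)) := by
  have h0 : Tendsto (fun i => C i ^ (κ + 1)) l atTop :=
    (tendsto_rpow_atTop (y := κ + 1) (by linarith)).comp hC
  have he : (fun i => C i ^ (κ + 1) * w) =ᶠ[l] fun i => C i ^ κ * (C i * w) := by
    filter_upwards [hC.eventually_gt_atTop 0] with i hi
    exact (rpow_mul_mul hi).symm
  rcases hw.lt_or_gt with hw | hw
  · rw [stepFun_of_neg hw]
    exact hb.comp ((h0.atTop_mul_const_of_neg hw).congr' he)
  · rw [stepFun_of_pos hw]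
    exact ha.comp ((h0.atTop_mul_const hw).congr' he)

end Rescaling

end BoundedQFT

theorem corollary3 (d : ℕ) (hd : 2 ≤ d) (m : ℝ) (hm : 0 < m) (L : ℝ) (hL : 0 < L) (lam κ : ℝ)
    (V : ℝ → ℝ) (hV : Measurable V) (hVb : ∃ M : ℝ, ∀ w, |V w| ≤ M)
    (ν : ℝ → Measure (TField d))
    (hν : ∀ Λ : ℝ, Real.exp 1 ≤ Λ →
      IsCenteredGaussian (ν Λ) (fun x => covCutoff d m Λ 0 * covCutoff d m Λ x)) :
    -- the functionals with cut-off are well defined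
    (∀ Λ : ℝ, Real.exp 1 ≤ Λ → ∀ J : 𝓢(Space d, ℝ),
      Integrable (fun φ : TField d => Real.exp (φ J)) (ν Λ) ∧
      Integrable (fun φ : TField d => Real.exp (φ J) *
        Real.exp (-lam * interaction L (fun w => V (covCutoff d m Λ 0 ^ κ * w)) φ)) (ν Λ)) ∧
    (κ < -1 → ∀ Vp Vm : ℝ, Tendsto V (𝓝[>] 0) (𝓝 Vp) → Tendsto V (𝓝[<] 0) (𝓝 Vm) →
      (∀ J : 𝓢(Space d, ℝ),
        Tendsto (fun Λ : ℝ =>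
            connectedGenerating (ν Λ) lam L (fun w => V (covCutoff d m Λ 0 ^ κ * w)) J)
          atTop (𝓝 (erfFunctional d m lam L Vp Vm J))) ∧
      (lam ≠ 0 → (IsNonGaussian (erfFunctional d m lam L Vp Vm) ↔ Vp ≠ Vm))) ∧
    (κ = -1 → ∀ J : 𝓢(Space d, ℝ),
      Tendsto (fun Λ : ℝ =>
          connectedGenerating (ν Λ) lam L (fun w => V (covCutoff d m Λ 0 ^ κ * w)) J)
        atTop (𝓝 (convFunctional d m lam L V J))) ∧
    (-1 < κ → ∀ Vp Vm : ℝ, Tendsto V atTop (𝓝 Vp) → Tendsto V atBot (𝓝 Vm) →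
      ∀ J : 𝓢(Space d, ℝ),
        Tendsto (fun Λ : ℝ =>
            connectedGenerating (ν Λ) lam L (fun w => V (covCutoff d m Λ 0 ^ κ * w)) J)
          atTop (𝓝 (erfFunctional d m lam L Vp Vm J))) := by

  obtain ⟨M, hM⟩ := hVb
  have hW : ∀ Λ : ℝ, Measurable fun w => V (covCutoff d m Λ 0 ^ κ * w) := fun Λ =>
    hV.comp (by fun_prop)
  have hC := tendsto_covCutoff_zero hd hm
  -- At `w = 0` the rescaled potential is stuck at `V 0`, unrelated to the limits; a null set is
  -- harmless.
  have hne : ∀ᵐ w : ℝ, w ≠ 0 := Measure.ae_ne volume 0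
  refine ⟨fun Λ hΛ J => ⟨(hν Λ hΛ).integrable_exp J,
      integrable_generating (hν Λ hΛ) (hW Λ) (fun w => hM _) lam J⟩,
    fun hκ Vp Vm hp hm' => ⟨fun J => ?_, fun hlam => isNonGaussian_erfFunctional_iff hm hL hlam Vp Vm⟩,
    fun hκ J => ?_, fun hκ Vp Vm hp hm' J => ?_⟩
  · rw [erfFunctional_eq_integral_gaussMean hm]
    exact tendsto_connectedGenerating hd hm lam L hν hW (fun Λ w => hM _)
      (hne.mono fun w hw => tendsto_rescale_zero hκ hC hp hm' hw) J
  · rw [convFunctional_eq]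
    refine tendsto_connectedGenerating hd hm lam L hν hW (fun Λ w => hM _)
      (Eventually.of_forall fun w => ?_) J
    -- At `κ = -1` the rescalings cancel exactly, so the potential is eventually constant in `Λ` and
    -- needs no regularity.
    refine tendsto_const_nhds.congr' ?_
    filter_upwards [hC.eventually_gt_atTop 0] with Λ hΛ
    rw [rpow_mul_mul hΛ, hκ]
    simp
  · rw [erfFunctional_eq_integral_gaussMean hm]
    exact tendsto_connectedGenerating hd hm lam L hν hW (fun Λ w => hM _)
      (hne.mono fun w hw => tendsto_rescale_infinity hκ hC hp hm' hw) J
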